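/- A Wang tile is a unit square with colored edges, written $(\text{right},\text{top},\text{left},\text{bottom})$. For a list $\tau_0,\dots,\tau_{n-1}$ of Wang tiles forming a set $\mathcal T$, the Wang shift $\Omega_{\mathcal T}$ is the set of all $x:\mathbb Z^2\to\{0,\dots,n-1\}$ such that the tiles $\tau_{x(m)}$ form a valid tiling: the right color at $m$ equals the left color at $m+(1,0)$, and the top color at $m$ equals the bottom color at $m+(0,1)$. The Jeandel--Rao tiles $\mathcal T_0=\{\tau_0,\dots,\tau_{10}\}$ are, in this order, $$(2,4,2,1),\ (2,2,2,0),\ (1,1,3,1),\ (1,2,3,2),\ (3,1,3,3),\ (0,1,3,1),\ (0,0,0,1),\ (3,1,0,2),\ (0,2,1,2),\ (1,2,1,4),\ (3,3,1,2).$$ Definition of $X_0$. Let $\Omega_5$ be the Wang shift of the $29$ tiles $0,\dots,28$ given, in this order, by $$(2113,5,2130,1),\ (2130,1,2103,5),\ (2133,1,2113,1),\ (2113,5,2330,0),\ (2130,6,2300,0),\ (2103,5,2310,0),\ (2310,1,2033,6),\ (2300,1,2033,6),\ (2300,0,2030,6),\ (2030,1,2103,0),\ (2033,1,2113,0),\ (2330,1,2133,6),\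 (2330,0,2130,6),\ (21113,5,21330,1),\ (21130,6,21300,1),\ (21103,5,21310,1),\ (21310,1,21033,5),\ (21310,0,21030,5),\ (21300,1,21033,5),\ (21300,0,21030,5),\ (21030,1,21103,1),\ (21033,1,21113,1),\ (21330,0,21130,1),\ (21330,0,21130,5),\ (21130,6,23300,0),\ (21030,6,23100,0),\ (23100,0,20330,6),\ (20330,0,21130,0),\ (23300,0,21330,6).$$ Let $\jmath:\{0,\dots,28\}\to\{0,\dots,27\}$ be given by $\jmath(k)=k$ for $k\le 22$ and $\jmath(k)=k-1$ for $k\ge 23$ (on tiles, it replaces the horizontal colors $5,6$ by $1,0$), and let $X_4=\{\jmath\circ x : x\in\Omega_5\}$. Let $\omega_3,\omega_2,\omega_1,\omega_0$ be the two-dimensional morphisms sending each letter to a column of height one or two. Here $a$ denotes a single letter, $a{\cdot}b$ denotes the column with $a$ at the bottom and $b$ on top, and the images of the letters $0,1,2,\dots$ are listed in order: - $\omega_3$ (from $\{0,\dots,27\}$ to words over $\{0,\dots,23\}$): $5,\ 8,\ 11,\ 12,\ 14,\ 15,\ 16,\ 17,\ 18,\ 19,\ 20,\ 22,\ 23,\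 4{\cdot}3,\ 5{\cdot}2,\ 6{\cdot}3,\ 7{\cdot}1,\ 7{\cdot}2,\ 8{\cdot}1,\ 8{\cdot}2,\ 9{\cdot}1,\ 10{\cdot}0,\ 11{\cdot}2,\ 12{\cdot}2,\ 15{\cdot}2,\ 16{\cdot}2,\ 20{\cdot}2,\ 22{\cdot}2$; - $\omega_2$ (from $\{0,\dots,23\}$ to words over $\{0,\dots,19\}$): $2,\ 3,\ 4,\ 5,\ 8{\cdot}1,\ 8{\cdot}5,\ 8{\cdot}6,\ 9{\cdot}0,\ 9{\cdot}3,\ 10{\cdot}5,\ 10{\cdot}7,\ 11{\cdot}2,\ 12{\cdot}5,\ 12{\cdot}6,\ 13{\cdot}4,\ 14{\cdot}5,\ 15{\cdot}3,\ 16{\cdot}3,\ 16{\cdot}4,\ 17{\cdot}3,\ 18{\cdot}2,\ 19{\cdot}0,\ 19{\cdot}3,\ 19{\cdot}4$; - $\omega_1$ (from $\{0,\dots,19\}$ to words over $\{0,\dots,12\}$): $0,\ 1,\ 2,\ 3,\ 4,\ 5,\ 6,\ 7,\ 8{\cdot}1,\ 8{\cdot}5,\ 8{\cdot}6,\ 8{\cdot}7,\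 9{\cdot}1,\ 9{\cdot}5,\ 9{\cdot}6,\ 10{\cdot}0,\ 10{\cdot}3,\ 11{\cdot}5,\ 11{\cdot}7,\ 12{\cdot}2$; - $\omega_0$ (from $\{0,\dots,12\}$ to words over $\{0,\dots,10\}$): $2,\ 3,\ 4,\ 5,\ 6,\ 7,\ 8,\ 10,\ 0{\cdot}9,\ 1{\cdot}3,\ 1{\cdot}7,\ 1{\cdot}8,\ 1{\cdot}10$. The image $\omega(x)$ of a configuration $x$ is obtained by replacing each letter of $x$ by its image, the bottom letter of the image of $x(0,0)$ being placed at the origin. For $i=3,2,1,0$ in turn, let $X_i$ be the set of all translates by vectors of $\mathbb Z^2$ of the configurations $\omega_i(x)$ with $x\in X_{i+1}$. The elements of $X_0$ are tilings by the Jeandel--Rao tiles. Horizontal strips. A horizontal strip of height $h\ge 1$ in a tiling $x\in X_0$ consists of $h$ consecutive rows such that every tile of the lowest row is $\tau_0$ or $\tau_1$ (the tiles whose left and right colors are $2$), and no tile of the other $h-1$ rows is $\tau_0$ or $\tau_1$. A sequence of strip heights of $x$ is a biinfinite sequence $(h_n)_{n\in\mathbb Z}$ for which there are integers $(r_n)_{n\in\mathbb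 Z}$ with $r_{n+1}=r_n+h_n$ such that, for every $n$, the rows $r_n,\dots,r_{n+1}-1$ of $x$ form a horizontal strip (of height $h_n$). **Proposition.** Every tiling in $X_0$ is a bi-infinite stack of horizontal strips, that is, it has a sequence of strip heights, and each of its strips has height $4$ or $5$. Let $\mathcal L$ be the set of all finite words over $\{4,5\}$ that occur as factors of the sequences of strip heights, read from bottom to top, of the tilings in $X_0$. Then $\mathcal L$ is exactly the set of finite factors of the Fibonacci word $5455454554\cdots$, the fixed point of the morphism $4\mapsto 5$, $5\mapsto 54$. -/

import Mathlib

namespace JeandelRao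

/-! ## Tilings, Wang shifts, morphisms -/

/-- A Wang tile: a unit square with a color on each of its four edges. -/
structure WangTile where
  right : ℕ
  top : ℕ
  left : ℕ
  bottom : ℕ

/-- Configurations `ℤ² → A`. -/
abbrev Config (A : Type) : Type := ℤ × ℤ → A

/-- The shift action, `(σᵏ x)_m = x_{m + k}`. -/
def shift {A : Type} (k : ℤ × ℤ) (x : Config A) : Config A := fun m => x (m + k)

/-- The Wang shift of the tiles `t 0, t 1, …`: the valid tilings of the plane, where a tiling
is recorded through the indices of its tiles. -/
def wangShift {ι : Type} (t : ι → WangTile) : Set (Config ι) :=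
  {x | ∀ m : ℤ × ℤ, (t (x m)).right = (t (x (m + (1, 0)))).left ∧
    (t (x m)).top = (t (x (m + (0, 1)))).bottom}

/-- A two-dimensional (rectangular) word in Cartesian coordinates: `letter a b` is in column `a`
(from the left) and row `b` (from the bottom). -/
structure Word₂ (A : Type) where
  width : ℕ
  height : ℕ
  letter : Fin width → Fin height → A

/-- The word of width one whose letters, from bottom to top, are those of `l`. -/
def column {A : Type} (l : List A) : Word₂ A where
  width := 1
  height := l.length
  letter := fun _ b => l.get b

/-- `y` is the image `ω(x)` of the configuration `x` under the two-dimensional morphism given on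
letters by `ω`: the words `ω(x_{i,j})` fit together into a grid with vertical cuts `c` and
horizontal cuts `r`, and the lower left letter of `ω(x_{0,0})` is at the origin. -/
def IsMorphismImage {A B : Type} (ω : A → Word₂ B) (x : Config A) (y : Config B) : Prop :=
  ∃ c r : ℤ → ℤ, c 0 = 0 ∧ r 0 = 0 ∧ ∀ i j : ℤ,
    c (i + 1) = c i + (ω (x (i, j))).width ∧
    r (j + 1) = r j + (ω (x (i, j))).height ∧
    ∀ (a : Fin (ω (x (i, j))).width) (b : Fin (ω (x (i, j))).height),
      y (c i + (a : ℕ), r j + (b : ℕ)) = (ω (x (i, j))).letter a b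

/-- The closure under the shift of the image `ω(X)`. -/
def shiftClosureImage {A B : Type} (ω : A → Word₂ B) (X : Set (Config A)) : Set (Config B) :=
  {y | ∃ x ∈ X, ∃ z, IsMorphismImage ω x z ∧ ∃ k : ℤ × ℤ, y = shift k z}

/-! ## The tile sets and the morphisms

Tiles are listed as `⟨right, top, left, bottom⟩`; images of letters are listed from bottom to
top. -/


/-- The Jeandel-Rao set of 11 Wang tiles. -/
def tiles₀ : Fin 11 → WangTile :=
  ![⟨2, 4, 2, 1⟩, ⟨2, 2, 2, 0⟩, ⟨1, 1, 3, 1⟩, ⟨1, 2, 3, 2⟩,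
    ⟨3, 1, 3, 3⟩, ⟨0, 1, 3, 1⟩, ⟨0, 0, 0, 1⟩, ⟨3, 1, 0, 2⟩,
    ⟨0, 2, 1, 2⟩, ⟨1, 2, 1, 4⟩, ⟨3, 3, 1, 2⟩]

/-- The set of 29 Wang tiles with decorated horizontal edges. -/
def tiles₅ : Fin 29 → WangTile :=
  ![⟨2113, 5, 2130, 1⟩, ⟨2130, 1, 2103, 5⟩, ⟨2133, 1, 2113, 1⟩, ⟨2113, 5, 2330, 0⟩,
    ⟨2130, 6, 2300, 0⟩, ⟨2103, 5, 2310, 0⟩, ⟨2310, 1, 2033, 6⟩, ⟨2300, 1, 2033, 6⟩,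
    ⟨2300, 0, 2030, 6⟩, ⟨2030, 1, 2103, 0⟩, ⟨2033, 1, 2113, 0⟩, ⟨2330, 1, 2133, 6⟩,
    ⟨2330, 0, 2130, 6⟩, ⟨21113, 5, 21330, 1⟩, ⟨21130, 6, 21300, 1⟩, ⟨21103, 5, 21310, 1⟩,
    ⟨21310, 1, 21033, 5⟩, ⟨21310, 0, 21030, 5⟩, ⟨21300, 1, 21033, 5⟩, ⟨21300, 0, 21030, 5⟩,
    ⟨21030, 1, 21103, 1⟩, ⟨21033, 1, 21113, 1⟩, ⟨21330, 0, 21130, 1⟩, ⟨21330, 0, 21130, 5⟩,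
    ⟨21130, 6, 23300, 0⟩, ⟨21030, 6, 23100, 0⟩, ⟨23100, 0, 20330, 6⟩, ⟨20330, 0, 21130, 0⟩,
    ⟨23300, 0, 21330, 6⟩]

/-- The morphism `ω₀ : Ω₁ → Ω₀`. -/
def omega₀ : Fin 13 → Word₂ (Fin 11) :=
  ![column [2], column [3], column [4], column [5], column [6], column [7],
    column [8], column [10], column [0, 9], column [1, 3], column [1, 7], column [1, 8],
    column [1, 10]]

/-- The morphism `ω₁ : Ω₂ → Ω₁`. -/
def omega₁ : Fin 20 → Word₂ (Fin 13) :=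
  ![column [0], column [1], column [2], column [3], column [4], column [5],
    column [6], column [7], column [8, 1], column [8, 5], column [8, 6], column [8, 7],
    column [9, 1], column [9, 5], column [9, 6], column [10, 0], column [10, 3], column [11, 5],
    column [11, 7], column [12, 2]]

/-- The morphism `ω₂ : Ω₃ → Ω₂`. -/
def omega₂ : Fin 24 → Word₂ (Fin 20) :=
  ![column [2], column [3], column [4], column [5], column [8, 1], column [8, 5],
    column [8, 6], column [9, 0], column [9, 3], column [10, 5], column [10, 7], column [11, 2],
    column [12, 5], column [12, 6], column [13, 4], column [14, 5], column [15, 3], column [16, 3],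
    column [16, 4], column [17, 3], column [18, 2], column [19, 0], column [19, 3], column [19, 4]]

/-- The morphism `ω₃'`, defined on the indices of a set of 30 tiles containing two useless ones. -/
def omega₃' : Fin 30 → Word₂ (Fin 24) :=
  ![column [5], column [8], column [11], column [12], column [14], column [15],
    column [16], column [17], column [18], column [19], column [20], column [22],
    column [23], column [4, 3], column [5, 2], column [6, 3], column [7, 1], column [7, 2],
    column [8, 1], column [8, 2], column [9, 1], column [10, 0], column [11, 2], column [12, 2],
    column [13, 3], column [15, 2], column [16, 2], column [20, 2], column [21, 2], column [22, 2]]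

/-- The inclusion of the 28 useful tiles among the 30 tiles. -/
def iota : Fin 28 → Fin 30 :=
  ![0, 1, 2, 3, 4, 5, 6, 7, 8, 9, 10, 11, 12, 13, 14,
    15, 16, 17, 18, 19, 20, 21, 22, 23, 25, 26, 27, 29]

/-- The morphism `ω₃ : Ω₄ → Ω₃`. -/
def omega₃ : Fin 28 → Word₂ (Fin 24) := omega₃' ∘ iota

/-- The removal of the decorations (horizontal colors 6 and 5 become 0 and 1), as a map on the
indices of tiles. -/
def jmath : Fin 29 → Fin 28 :=
  ![0, 1, 2, 3, 4, 5, 6, 7, 8, 9, 10, 11, 12, 13, 14,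
    15, 16, 17, 18, 19, 20, 21, 22, 22, 23, 24, 25, 26, 27]

/-! ## The subshift `X₀` -/

/-- `X₄ = ȷ(Ω₅)`. -/
def X₄ : Set (Config (Fin 28)) := (fun x => jmath ∘ x) '' wangShift tiles₅

/-- `X₃`, the shift closure of `ω₃(X₄)`. -/
def X₃ : Set (Config (Fin 24)) := shiftClosureImage omega₃ X₄

/-- `X₂`, the shift closure of `ω₂(X₃)`. -/
def X₂ : Set (Config (Fin 20)) := shiftClosureImage omega₂ X₃

/-- `X₁`, the shift closure of `ω₁(X₂)`. -/
def X₁ : Set (Config (Fin 13)) := shiftClosureImage omega₁ X₂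

/-- `X₀`, the shift closure of `ω₀(X₁)`: a set of tilings by the Jeandel-Rao tiles. -/
def X₀ : Set (Config (Fin 11)) := shiftClosureImage omega₀ X₁

/-! ## Horizontal strips -/

/-- The tiles that are the transitions of the connected component `T₁` of the transducer of the
Jeandel-Rao tiles. Its only state is the vertical color `2`; all the other tiles are transitions
of the component `T₀`, whose states are `0`, `1`, `3`. -/
def InT₁ (t : Fin 11) : Prop := (tiles₀ t).left = 2 ∧ (tiles₀ t).right = 2

/-- The rows `j, j + 1, …, j + h - 1` of `x` form a horizontal strip of height `h`, that is, a
strip generated by the product `T₁T₀⋯T₀` with `h` factors, from bottom to top. -/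
def IsStrip (x : Config (Fin 11)) (j : ℤ) (h : ℕ) : Prop :=
  0 < h ∧ (∀ i : ℤ, InT₁ (x (i, j))) ∧
    ∀ k : ℕ, 0 < k → k < h → ∀ i : ℤ, ¬ InT₁ (x (i, j + k))

/-- The tiling `x` is cut into consecutive horizontal strips: the `n`-th one starts in row `r n`
and has height `h n`, and the next one lies directly above it. -/
def IsStripDecomposition (x : Config (Fin 11)) (r : ℤ → ℤ) (h : ℤ → ℕ) : Prop :=
  ∀ n : ℤ, IsStrip x (r n) (h n) ∧ r (n + 1) = r n + h n

/-- The biinfinite sequences of heights of the horizontal strips, from bottom to top, of the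
tilings in `X`. -/
def stripSequences (X : Set (Config (Fin 11))) : Set (ℤ → ℕ) :=
  {h | ∃ x ∈ X, ∃ r : ℤ → ℤ, IsStripDecomposition x r h}

/-- The language (set of finite factors) of a set of biinfinite sequences. -/
def language (S : Set (ℤ → ℕ)) : Set (List ℕ) :=
  {u | ∃ h ∈ S, ∃ n : ℤ, u = (List.range u.length).map fun i : ℕ => h (n + i)}

/-! ## The Fibonacci word -/

/-- The morphism `4 ↦ 5`, `5 ↦ 54` (only the letters `4` and `5` matter). -/
def fibSubst (a : ℕ) : List ℕ := if a = 5 then [5, 4] else [5]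

/-- The prefix of length `n` of an infinite word. -/
def wordPrefix (w : ℕ → ℕ) (n : ℕ) : List ℕ := (List.range n).map w

/-- `w` is fixed by the substitution `s`: the image of every prefix of `w` is a prefix of `w`. -/
def IsFixedPoint (s : ℕ → List ℕ) (w : ℕ → ℕ) : Prop :=
  ∀ n : ℕ, (wordPrefix w n).flatMap s = wordPrefix w ((wordPrefix w n).flatMap s).length

/-- The `n`-th iterate of the substitution on the word `5`. -/
def fibIter : ℕ → List ℕ
  | 0 => [5]
  | n + 1 => (fibIter n).flatMap fibSubst

/-- The Fibonacci word over `{4, 5}`; see `existsUnique_isFixedPoint` and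
`fibWord_isFixedPoint`. -/
def fibWord (n : ℕ) : ℕ := (fibIter n).getD n 5

/-- The language (set of finite factors) of an infinite word. -/
def wordLanguage (w : ℕ → ℕ) : Set (List ℕ) :=
  {u | ∃ n : ℕ, u = (List.range u.length).map fun i : ℕ => w (n + i)}

theorem length_wordPrefix (w : ℕ → ℕ) (n : ℕ) : (wordPrefix w n).length = n := by
  simp [wordPrefix]

theorem flatMap_isPrefix {s : ℕ → List ℕ} {u v : List ℕ} (h : u <+: v) :
    u.flatMap s <+: v.flatMap s := by
  obtain ⟨t, rfl⟩ := h
  exact ⟨t.flatMap s, by simp⟩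

theorem length_le_length_flatMap_fibSubst (u : List ℕ) :
    u.length ≤ (u.flatMap fibSubst).length := by
  induction u with
  | nil => simp
  | cons a u ih =>
    simp only [List.flatMap_cons, List.length_append, List.length_cons, fibSubst]
    split <;> simp only [List.length_cons, List.length_nil] <;> omega

theorem fibIter_head (n : ℕ) : ∃ t, fibIter n = 5 :: t := by
  induction n with
  | zero => exact ⟨[], rfl⟩
  | succ n ih =>
    obtain ⟨t, ht⟩ := ih
    exact ⟨4 :: t.flatMap fibSubst, by simp [fibIter, ht, fibSubst]⟩

theorem lt_length_fibIter (n : ℕ) : n < (fibIter n).length := by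
  induction n with
  | zero => simp [fibIter]
  | succ n ih =>
    obtain ⟨t, ht⟩ := fibIter_head n
    have h := length_le_length_flatMap_fibSubst t
    simp only [fibIter, ht, List.flatMap_cons, List.length_append, List.length_cons] at ih ⊢
    simp only [fibSubst, if_true, List.length_cons, List.length_nil]
    omega

theorem fibIter_isPrefix_succ (n : ℕ) : fibIter n <+: fibIter (n + 1) := by
  induction n with
  | zero => exact ⟨[4], rfl⟩
  | succ n ih => exact flatMap_isPrefix ih

theorem fibIter_isPrefix {m n : ℕ} (h : m ≤ n) : fibIter m <+: fibIter n := by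
  induction n, h using Nat.le_induction with
  | base => exact List.prefix_rfl
  | succ n _ ih => exact ih.trans (fibIter_isPrefix_succ n)

theorem getElem_fibIter {n k : ℕ} (hk : k < (fibIter n).length) :
    (fibIter n)[k] = fibWord k := by
  have hk' := lt_length_fibIter k
  rw [fibWord, List.getD_eq_getElem _ _ hk']
  rcases le_total n k with h | h
  · exact (fibIter_isPrefix h).getElem hk
  · exact ((fibIter_isPrefix h).getElem hk').symm

theorem eq_wordPrefix_of_isPrefix {u : List ℕ} {n : ℕ} (h : u <+: fibIter n) :
    u = wordPrefix fibWord u.length := by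
  refine List.ext_getElem (length_wordPrefix _ _).symm fun k hk _ => ?_
  rw [h.getElem hk, getElem_fibIter]
  simp [wordPrefix]

theorem wordPrefix_isPrefix (n : ℕ) : wordPrefix fibWord n <+: fibIter n := by
  have h : (fibIter n).take n <+: fibIter n := List.take_prefix _ _
  have h2 := eq_wordPrefix_of_isPrefix h
  rw [List.length_take, min_eq_left (lt_length_fibIter n).le] at h2
  rwa [h2] at h

theorem fibWord_isFixedPoint : IsFixedPoint fibSubst fibWord := fun n =>
  eq_wordPrefix_of_isPrefix (n := n + 1) (flatMap_isPrefix (wordPrefix_isPrefix n))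

theorem fibIter_eq_of_isFixedPoint {w : ℕ → ℕ} (hw : IsFixedPoint fibSubst w) (n : ℕ) :
    fibIter n = wordPrefix w (fibIter n).length := by
  induction n with
  | zero =>
    by_cases h5 : w 0 = 5
    · simp [fibIter, wordPrefix, h5]
    · have h := hw 1
      have e : (wordPrefix w 1).flatMap fibSubst = [5] := by simp [wordPrefix, fibSubst, h5]
      rw [e] at h
      simp [wordPrefix] at h
      exact absurd h.symm h5
  | succ n ih =>
    have h := hw (fibIter n).length
    rw [← ih] at h
    exact h

/-- The Fibonacci word is the only fixed point of the substitution. -/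
theorem existsUnique_isFixedPoint : ∃! w : ℕ → ℕ, IsFixedPoint fibSubst w := by
  refine ⟨fibWord, fibWord_isFixedPoint, fun w hw => funext fun k => ?_⟩
  have hk := lt_length_fibIter k
  rw [← getElem_fibIter hk]
  have h := fibIter_eq_of_isFixedPoint hw k
  have h2 : (fibIter k)[k]? = (wordPrefix w (fibIter k).length)[k]? := congrArg (·[k]?) h
  rw [List.getElem?_eq_getElem hk] at h2
  simp [wordPrefix, hk] at h2
  exact h2.symm

end JeandelRao

namespace JeandelRao

/-! ## Factors and expansions of biinfinite sequences -/

/-! Under `jmath` and the four column morphisms, a tile of `tiles₅` becomes a column of 4 or 5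
Jeandel-Rao tiles of which exactly the bottom one is τ₀ or τ₁. Horizontal neighbours give columns of
equal height, so the rows of a tiling in Ω₅ become the strips of its image. Strip boundaries are
determined by the tiling; hence a sequence of strip heights is, up to a translation of the indices,
the sequence of `tileHeight` up a column of a tiling in Ω₅ (`exists_strips`,
`exists_tileHeight_eq`).

These sequences have a hierarchical structure. Dominoes that cannot be continued are discarded, the
tilings are sheared, and entire lines of marked letters are merged with a neighbouring line. Two
mergings lead to tilings over 25 letters with dominoes in `coreDominoes`; four more lead from these
back to tilings with the same dominoes. Following the row types through the mergings, a height
sequence is the image under `fibSubst` of a core sequence (`exists_expands_fibSubst`), and every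
core sequence is the image of another one under `coreSubst`, which is 4 ↦ 45, 5 ↦ 455
(`IsCoreSequence.exists_expands`). All this rests on finite checks on dominoes.

Now 5·`coreSubst`(u) = `fibSubst`²(u)·5 for every word u. So `coreSubst` preserves Fibonacci
factors, and desubstitution shortens factors of core sequences until a finite check suffices.
Conversely, the same identity makes every `fibIter (2 * n)` occur in every core sequence. Each
tiling in X₀ thus already shows the whole language, and it remains to see that X₀ is nonempty: a
two-dimensional substitution on the 25 letters produces arbitrarily large patches, and compactness
gives a tiling. -/

/-- The factor of length `n` of `u` starting at position `p`. -/
def segment {B : Type*} (u : ℤ → B) (p : ℤ) (n : ℕ) : List B :=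
  (List.range n).map fun i : ℕ => u (p + i)

@[simp] theorem length_segment {B : Type*} (u : ℤ → B) (p : ℤ) (n : ℕ) :
    (segment u p n).length = n := by simp [segment]

theorem segment_add {B : Type*} (u : ℤ → B) (p : ℤ) (m n : ℕ) :
    segment u p (m + n) = segment u p m ++ segment u (p + m) n := by
  simp [segment, List.range_add, add_assoc]

theorem segment_one {B : Type*} (u : ℤ → B) (p : ℤ) : segment u p 1 = [u p] := by
  simp [segment]

theorem getElem_segment {B : Type*} (u : ℤ → B) (p : ℤ) (n i : ℕ)
    (hi : i < (segment u p n).length) : (segment u p n)[i] = u (p + i) := by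
  simp [segment]

theorem segment_isInfix {B : Type*} (u : ℤ → B) {p q : ℤ} {m n : ℕ} (h₁ : p ≤ q)
    (h₂ : q + m ≤ p + n) : segment u q m <:+: segment u p n := by
  obtain ⟨a, ha⟩ := Int.eq_ofNat_of_zero_le (sub_nonneg.2 h₁)
  obtain ⟨b, hb⟩ := Int.eq_ofNat_of_zero_le (sub_nonneg.2 h₂)
  have e : n = a + m + b := by omega
  have e' : q = p + a := by omega
  subst e e'
  rw [segment_add, segment_add]
  exact ⟨_, _, rfl⟩

theorem exists_segment_of_isInfix {B : Type*} {u : ℤ → B} {v w : List B} {p : ℤ}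
    (hv : segment u p v.length = v) (h : w <:+: v) : ∃ q, w = segment u q w.length := by
  obtain ⟨a, b, hab⟩ := h
  rw [← hv] at hab
  have hl := congrArg List.length hab
  simp only [List.length_append, length_segment] at hl
  rw [← hl, segment_add, segment_add] at hab
  have h1 := List.append_inj_left hab (by simp)
  exact ⟨p + a.length, List.append_inj_right h1 (by simp)⟩

/-- `u` is obtained from `s` by replacing each letter by its image under `f`, the image of the
letter at position `j` being placed at position `r j`. -/
def Expands {A B : Type*} (f : A → List B) (r : ℤ → ℤ) (s : ℤ → A) (u : ℤ → B) : Prop :=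
  ∀ j, r (j + 1) = r j + (f (s j)).length ∧ segment u (r j) (f (s j)).length = f (s j)

theorem Expands.segment_eq {A B : Type*} {f : A → List B} {r : ℤ → ℤ} {s : ℤ → A} {u : ℤ → B}
    (h : Expands f r s u) (j : ℤ) (n : ℕ) :
    r (j + n) = r j + ((segment s j n).flatMap f).length ∧
      segment u (r j) ((segment s j n).flatMap f).length = (segment s j n).flatMap f := by
  induction n with
  | zero => simp [segment]
  | succ n ih =>
    obtain ⟨h₁, h₂⟩ := h (j + n)
    rw [segment_add, List.flatMap_append, segment_one, List.flatMap_singleton, List.length_append,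
      segment_add, ih.2, ← ih.1, h₂, Nat.cast_succ, ← add_assoc, h₁, ih.1]
    simp [add_assoc]

theorem Expands.comp {A B C : Type*} {f : A → List B} {g : B → List C} {r q : ℤ → ℤ} {s : ℤ → A}
    {u : ℤ → B} {v : ℤ → C} (hf : Expands f r s u) (hg : Expands g q u v) :
    Expands (fun a => (f a).flatMap g) (q ∘ r) s v := by
  intro j
  obtain ⟨h₁, h₂⟩ := hf j
  have h := hg.segment_eq (r j) (f (s j)).length
  rw [h₂, ← h₁] at h
  exact h

theorem exists_mem_block {r : ℤ → ℤ} (hr : ∀ j, r j < r (j + 1)) (p : ℤ) :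
    ∃ j, r j ≤ p ∧ p < r (j + 1) := by
  induction p using Int.inductionOn' (b := r 0) with
  | zero => exact ⟨0, le_rfl, hr 0⟩
  | succ k _ ih =>
    obtain ⟨j, h₁, h₂⟩ := ih
    by_cases h : k + 1 < r (j + 1)
    · exact ⟨j, by omega, h⟩
    · exact ⟨j + 1, by omega, by have := hr (j + 1); omega⟩
  | pred k _ ih =>
    obtain ⟨j, h₁, h₂⟩ := ih
    by_cases h : r j ≤ k - 1
    · exact ⟨j, h, by omega⟩
    · have := hr (j - 1)
      rw [sub_add_cancel] at this
      exact ⟨j - 1, by omega, by rw [sub_add_cancel]; omega⟩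

/-- The block containing position `p` covers at least that position, and each later block covers at
least `k` more, so `1 + m` blocks reach past `1 + k * m` positions. -/
theorem Expands.isInfix {A B : Type*} {f : A → List B} {r : ℤ → ℤ} {s : ℤ → A} {u : ℤ → B}
    (h : Expands f r s u) {k : ℕ} (hk : 1 ≤ k) (hf : ∀ j, k ≤ (f (s j)).length) (p : ℤ) (l m : ℕ)
    (hl : l ≤ 1 + k * m) : ∃ j, segment u p l <:+: (segment s j (1 + m)).flatMap f := by
  have hstep : ∀ j, r j + k ≤ r (j + 1) := fun j => by
    have h₁ := hf j
    have h₂ := (h j).1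
    omega
  obtain ⟨j, h₁, h₂⟩ := exists_mem_block (r := r) (fun j => by have := hstep j; omega) p
  have key : ∀ m : ℕ, p + 1 + k * m ≤ r (j + (1 + m : ℕ)) := by
    intro m
    induction m with
    | zero => simpa using h₂
    | succ m ih =>
      have := hstep (j + (1 + m : ℕ))
      have e : j + ((1 + (m + 1) : ℕ) : ℤ) = j + (1 + m : ℕ) + 1 := by push_cast; ring
      rw [e]
      push_cast at *
      linarith
  obtain ⟨e₁, e₂⟩ := h.segment_eq j (1 + m)
  refine ⟨j, ?_⟩
  rw [← e₂]
  refine segment_isInfix u h₁ ?_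
  rw [← e₁]
  have := key m
  zify at hl
  linarith

/-! ## Biinfinite orbits and cuts -/

/-- A right inverse of `next` is enough: the backward half of the orbit only has to be undone by
`next`. -/
theorem exists_orbit {α : Type*} (next prev : α → α) (h : ∀ a, next (prev a) = a) (a : α) :
    ∃ r : ℤ → α, r 0 = a ∧ ∀ n, r (n + 1) = next (r n) := by
  refine ⟨fun n => match n with
    | Int.ofNat n => next^[n] a
    | Int.negSucc n => prev^[n + 1] a, rfl, fun n => ?_⟩
  match n with
  | Int.ofNat n => exact Function.iterate_succ_apply' next n a
  | Int.negSucc 0 => exact (h a).symm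
  | Int.negSucc (n + 1) =>
    change prev^[n + 1] a = next (prev^[n + 1 + 1] a)
    rw [Function.iterate_succ_apply' prev (n + 1), h]

theorem exists_cuts (w : ℤ → ℕ) : ∃ c : ℤ → ℤ, c 0 = 0 ∧ ∀ i, c (i + 1) = c i + w i := by
  obtain ⟨r, h₀, h₁⟩ := exists_orbit (fun p : ℤ × ℤ => (p.1 + 1, p.2 + w p.1))
    (fun p => (p.1 - 1, p.2 - w (p.1 - 1))) (fun p => by simp) (0, 0)
  have hr : ∀ i, (r i).1 = i := by
    intro i
    induction i using Int.induction_on with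
    | zero => rw [h₀]
    | succ k ih => rw [h₁]; simp [ih]
    | pred k ih =>
      have := congrArg Prod.fst (h₁ (-k - 1))
      simp only [sub_add_cancel] at this
      linarith
  exact ⟨fun i => (r i).2, by simp [h₀], fun i => by simp [h₁, hr]⟩

theorem eq_of_mem_block {c : ℤ → ℤ} (h : ∀ i, c i < c (i + 1)) {i j p : ℤ} (hi : c i ≤ p)
    (hi' : p < c (i + 1)) (hj : c j ≤ p) (hj' : p < c (j + 1)) : i = j := by
  have hc := strictMono_int_of_lt_succ h
  have h₁ : i < j + 1 := hc.lt_iff_lt.1 (hi.trans_lt hj')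
  have h₂ : j < i + 1 := hc.lt_iff_lt.1 (hj.trans_lt hi')
  omega

/-- Cuts between positions that are joined in disjoint pairs. -/
theorem exists_pair_cuts {J : ℤ → Prop} [DecidablePred J] (hJ : ∀ j, J j → ¬ J (j + 1)) :
    ∃ r : ℤ → ℤ, ∀ n, ¬ J (r n - 1) ∧ r (n + 1) = r n + if J (r n) then 2 else 1 := by
  -- One of the positions 1 and 2 is a cut, since joins at 0 and at 1 exclude each other.
  have hs : ∃ p, ¬ J (p - 1) := by
    by_cases h : J 0
    · exact ⟨2, hJ 0 h⟩
    · exact ⟨1, h⟩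
  obtain ⟨p, hp⟩ := hs
  obtain ⟨r, -, hr⟩ := exists_orbit (α := {p : ℤ // ¬ J (p - 1)})
    (fun p => ⟨p.1 + if J p.1 then 2 else 1, by
      split_ifs with h
      · have := hJ _ h
        rwa [show p.1 + 2 - 1 = p.1 + 1 by ring]
      · rwa [add_sub_cancel_right]⟩)
    -- The block ending just before the cut `p` starts at `p - 2` if `p - 2` and `p - 1` are joined,
    -- and at `p - 1` otherwise.
    (fun p => ⟨p.1 - if J (p.1 - 2) then 2 else 1, by
      split_ifs with h
      · intro h'
        have := hJ _ h'
        rw [show p.1 - 2 - 1 + 1 = p.1 - 2 by ring] at this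
        exact this h
      · rwa [show p.1 - 1 - 1 = p.1 - 2 by ring]⟩)
    (fun p => by
      apply Subtype.ext
      by_cases h : J (p.1 - 2)
      · simp [h]
      · simp [h, p.2]) ⟨p, hp⟩
  exact ⟨fun n => (r n).1, fun n => ⟨(r n).2, congrArg Subtype.val (hr n)⟩⟩

/-! ## Configurations with prescribed dominoes -/

/-- `(0, a, b)` stands for `b` to the right of `a`, and `(1, a, b)` for `b` above `a`. -/
abbrev Domino : Type := ℕ × ℕ × ℕ

/-- The configurations `x` whose dominoes belong to `D`; the first index runs in the direction of
the dominoes of orientation `o`, the second one in the direction of those of orientation `o'`. -/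
def IsTiling (o o' : ℕ) (D : List Domino) (x : ℤ → ℤ → ℕ) : Prop :=
  ∀ i j, (o, x i j, x (i + 1) j) ∈ D ∧ (o', x i j, x i (j + 1)) ∈ D

theorem IsTiling.transpose {o o' : ℕ} {D : List Domino} {x : ℤ → ℤ → ℕ}
    (h : IsTiling o o' D x) : IsTiling o' o D fun i j => x j i := fun i j => (h j i).symm

/-- This is how marks, tile heights and row types, compared domino by domino, become functions of
the row alone. -/
theorem IsTiling.iff_of_fst {o o' : ℕ} {D : List Domino} {x : ℤ → ℤ → ℕ} (hx : IsTiling o o' D x)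
    {P : ℕ → Prop} (h : ∀ p ∈ D, p.1 = o → (P p.2.1 ↔ P p.2.2)) (i i' j : ℤ) :
    P (x i j) ↔ P (x i' j) := by
  have key : ∀ i, P (x i j) ↔ P (x 0 j) := by
    intro i
    induction i using Int.induction_on with
    | zero => rfl
    | succ k ih => exact (h _ (hx k j).1 rfl).symm.trans ih
    | pred k ih =>
      have := h _ (hx (-k - 1) j).1 rfl
      rw [sub_add_cancel] at this
      exact this.trans ih
  exact (key i).trans (key i').symm

/-- The domino `p` has no continuation above it (if horizontal) or to its right (if vertical). -/
def NoSuccessor (p : Domino) (D : List Domino) : Prop :=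
  ∀ q ∈ D, q.1 = 1 - p.1 → q.2.1 = p.2.1 → ∀ q' ∈ D, q'.1 = 1 - p.1 → q'.2.1 = p.2.2 →
    (p.1, q.2.2, q'.2.2) ∉ D

/-- The domino `p` has no continuation below it (if horizontal) or to its left (if vertical). -/
def NoPredecessor (p : Domino) (D : List Domino) : Prop :=
  ∀ q ∈ D, q.1 = 1 - p.1 → q.2.2 = p.2.1 → ∀ q' ∈ D, q'.1 = 1 - p.1 → q'.2.2 = p.2.2 →
    (p.1, q.2.1, q'.2.1) ∉ D

/-- The dominoes of `R` can be removed one after the other from `R ++ D`, the last one first,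
because they have no continuation. -/
def Removable : List Domino → List Domino → Prop
  | [], _ => True
  | p :: R, D => (NoSuccessor p (p :: D) ∨ NoPredecessor p (p :: D)) ∧ Removable R (p :: D)

/-- Evaluates `NoSuccessor`. -/
def noSuccessor (o a b : ℕ) (D : List Domino) : Bool :=
  D.all fun q => !(q.2.1.beq a && q.1.beq (1 - o)) ||
    D.all fun q' => !(q'.2.1.beq b && q'.1.beq (1 - o)) ||
      !D.any fun p => p.2.1.beq q.2.2 && p.2.2.beq q'.2.2 && p.1.beq o

/-- Evaluates `NoPredecessor`. -/
def noPredecessor (o a b : ℕ) (D : List Domino) : Bool :=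
  D.all fun q => !(q.2.2.beq a && q.1.beq (1 - o)) ||
    D.all fun q' => !(q'.2.2.beq b && q'.1.beq (1 - o)) ||
      !D.any fun p => p.2.1.beq q.2.1 && p.2.2.beq q'.2.1 && p.1.beq o

/-- The Boolean form, which compares numbers by `Nat.beq`, is meant for evaluation by the kernel. -/
instance (p : Domino) (D : List Domino) : Decidable (NoSuccessor p D) :=
  decidable_of_iff (noSuccessor p.1 p.2.1 p.2.2 D = true) <| by
    simp only [noSuccessor, NoSuccessor, List.all_eq_true, List.any_eq_true, Bool.or_eq_true,
      Bool.not_eq_true', Bool.and_eq_true, ← Bool.not_eq_true, Nat.beq_eq, ← imp_iff_not_or]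
    exact ⟨fun h q hq e₁ e₂ q' hq' e₃ e₄ hm => h q hq ⟨e₂, e₁⟩ q' hq' ⟨e₄, e₃⟩
      ⟨_, hm, ⟨rfl, rfl⟩, rfl⟩, fun h q hq e q' hq' e' ⟨p', hp', ⟨f₁, f₂⟩, f₃⟩ =>
        h q hq e.2 e.1 q' hq' e'.2 e'.1 (f₁ ▸ f₂ ▸ f₃ ▸ hp')⟩

instance (p : Domino) (D : List Domino) : Decidable (NoPredecessor p D) :=
  decidable_of_iff (noPredecessor p.1 p.2.1 p.2.2 D = true) <| by
    simp only [noPredecessor, NoPredecessor, List.all_eq_true, List.any_eq_true, Bool.or_eq_true,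
      Bool.not_eq_true', Bool.and_eq_true, ← Bool.not_eq_true, Nat.beq_eq, ← imp_iff_not_or]
    exact ⟨fun h q hq e₁ e₂ q' hq' e₃ e₄ hm => h q hq ⟨e₂, e₁⟩ q' hq' ⟨e₄, e₃⟩
      ⟨_, hm, ⟨rfl, rfl⟩, rfl⟩, fun h q hq e q' hq' e' ⟨p', hp', ⟨f₁, f₂⟩, f₃⟩ =>
        h q hq e.2 e.1 q' hq' e'.2 e'.1 (f₁ ▸ f₂ ▸ f₃ ▸ hp')⟩

instance decidableRemovable : ∀ R D : List Domino, Decidable (Removable R D)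
  | [], _ => isTrue trivial
  | _ :: R, _ => @instDecidableAnd _ _ _ (decidableRemovable R _)

theorem IsTiling.mono {o o' : ℕ} {D E : List Domino} {x : ℤ → ℤ → ℕ} (hx : IsTiling o o' D x)
    (h : D ⊆ E) : IsTiling o o' E x := fun i j => ⟨h (hx i j).1, h (hx i j).2⟩

/-- In a tiling every domino lies in a 2×2 square on either side of it. If no such square can be
formed on one side, the domino does not occur; its removal may block further ones, whence the
recursion. -/
theorem IsTiling.of_removable {R D : List Domino} {x : ℤ → ℤ → ℕ} (h : Removable R D)
    (hx : IsTiling 0 1 (R ++ D) x) : IsTiling 0 1 D x := by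
  induction R generalizing D with
  | nil => exact hx
  | cons p R ih =>
    -- The dominoes of `R` are removed first, while `p` still counts as admissible.
    replace hx := ih h.2 (hx.mono fun q hq => by simpa [or_left_comm] using hq)
    refine fun i j => ?_
    have h₁ : (0, x i j, x (i + 1) j) ≠ p := by
      rintro rfl
      rcases h.1 with h | h
      · exact h _ (hx i j).2 rfl rfl _ (hx (i + 1) j).2 rfl rfl (hx i (j + 1)).1
      · have e₁ := hx i (j - 1)
        have e₂ := hx (i + 1) (j - 1)
        rw [sub_add_cancel] at e₁ e₂
        exact h _ e₁.2 rfl rfl _ e₂.2 rfl rfl e₁.1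
    have h₂ : (1, x i j, x i (j + 1)) ≠ p := by
      rintro rfl
      rcases h.1 with h | h
      · exact h _ (hx i j).1 rfl rfl _ (hx i (j + 1)).1 rfl rfl (hx (i + 1) j).2
      · have e₁ := hx (i - 1) j
        have e₂ := hx (i - 1) (j + 1)
        rw [sub_add_cancel] at e₁ e₂
        exact h _ e₁.1 rfl rfl _ e₂.1 rfl rfl e₁.2
    exact ⟨((List.mem_cons.1 (hx i j).1).resolve_left h₁),
      ((List.mem_cons.1 (hx i j).2).resolve_left h₂)⟩

/-! ## Merging adjacent rows or columns -/

/-- The two letters of `p` are joined: the second one is marked (if `up`), or the first one. -/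
def Joined (up : Bool) (M : List ℕ) (p : ℕ × ℕ) : Prop := (cond up p.2 p.1) ∈ M

instance (up : Bool) (M : List ℕ) (p : ℕ × ℕ) : Decidable (Joined up M p) := by
  unfold Joined; infer_instance

/-- Conditions under which marked letters of the tilings by the dominoes `D` fill entire lines, no
two of which are adjacent, and the merging of each marked line with the line before (if `up`) or
after it, where `W` lists the resulting blocks, gives tilings by the dominoes `E`. -/
structure IsMerging (up : Bool) (o o' : ℕ) (M : List ℕ) (W : List (List ℕ))
    (D E : List Domino) : Prop where
  mem_iff : ∀ p ∈ D, p.1 = o → (p.2.1 ∈ M ↔ p.2.2 ∈ M)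
  not_mem : ∀ p ∈ D, p.1 = o' → p.2.1 ∈ M → p.2.2 ∉ M
  pair : ∀ p ∈ D, p.1 = o' → Joined up M p.2 → [p.2.1, p.2.2] ∈ W
  single : ∀ p ∈ D, p.1 = o' → p.2.1 ∉ M → p.2.2 ∉ M → [cond up p.2.1 p.2.2] ∈ W
  side : ∀ p ∈ D, p.1 = o → ∀ u ∈ W.zipIdx, u.1.head? = some p.2.1 →
    ∀ v ∈ W.zipIdx, v.1.head? = some p.2.2 → u.1.length = v.1.length →
    (∀ q ∈ u.1.zip v.1, (o, q) ∈ D) → (o, u.2, v.2) ∈ E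
  next : ∀ p ∈ D, p.1 = o' → ∀ u ∈ W.zipIdx, u.1.getLast? = some p.2.1 →
    ∀ v ∈ W.zipIdx, v.1.head? = some p.2.2 → (o', u.2, v.2) ∈ E

set_option synthInstance.maxSize 1024 in
set_option synthInstance.maxHeartbeats 400000 in
instance (up : Bool) (o o' : ℕ) (M : List ℕ) (W : List (List ℕ)) (D E : List Domino) :
    Decidable (IsMerging up o o' M W D E) :=
  decidable_of_iff (_ ∧ _ ∧ _ ∧ _ ∧ _ ∧ _)
    ⟨fun ⟨a, b, c, d, e, f⟩ => ⟨a, b, c, d, e, f⟩, fun ⟨a, b, c, d, e, f⟩ => ⟨a, b, c, d, e, f⟩⟩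

/-- Marked lines are isolated, so joining each to its neighbour cuts the plane into blocks of one or
two lines. Marks are constant along lines, so the cuts are common to all columns. -/
theorem IsMerging.exists_expands {up : Bool} {o o' : ℕ} {M : List ℕ} {W : List (List ℕ)}
    {D E : List Domino} (h : IsMerging up o o' M W D E) {x : ℤ → ℤ → ℕ}
    (hx : IsTiling o o' D x) :
    ∃ y r, IsTiling o o' E y ∧
      ∀ i, Expands (fun k => W.getD k []) r (y i) (x i) ∧ ∀ j, W.getD (y i j) [] ≠ [] := by
  have hrow := fun i i' j => hx.iff_of_fst (P := (· ∈ M)) h.mem_iff i i' j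
  -- Lines `j` and `j + 1` belong to the same block; column 0 decides for all columns.
  let J : ℤ → Prop := fun j => Joined up M (x 0 j, x 0 (j + 1))
  have hJrow : ∀ i j, J j ↔ Joined up M (x i j, x i (j + 1)) := by
    intro i j
    cases up <;> exact hrow _ _ _
  have hJ : ∀ j, J j → ¬ J (j + 1) := by
    intro j
    cases up
    · exact h.not_mem _ (hx 0 j).2 rfl
    · exact h.not_mem _ (hx 0 (j + 1)).2 rfl
  obtain ⟨r, hr⟩ := exists_pair_cuts (J := J) hJ
  have hr₁ := fun n => (hr n).1
  have hr₂ := fun n => (hr n).2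
  clear hr
  set w : ℤ → ℤ → List ℕ := fun i n => segment (x i) (r n) (if J (r n) then 2 else 1) with hw
  have hmem : ∀ i n, w i n ∈ W := by
    intro i n
    by_cases hj : J (r n)
    · have := h.pair _ (hx i (r n)).2 rfl ((hJrow i _).1 hj)
      simpa [hw, hj, segment, List.range_succ] using this
    · simp only [hw, hj, if_false, segment_one]
      have h₁ := hr₁ n
      cases up
      · rw [hJrow i, sub_add_cancel] at h₁
        rw [hJrow i] at hj
        have := h.single _ (hx i (r n - 1)).2 rfl
        rw [sub_add_cancel] at this
        exact this h₁ hj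
      · rw [hJrow i, sub_add_cancel] at h₁
        rw [hJrow i] at hj
        exact h.single _ (hx i (r n)).2 rfl h₁ hj
  -- The new letter is the index of its block in `W`.
  have hzip : ∀ i n, (w i n, W.idxOf (w i n)) ∈ W.zipIdx := by
    intro i n
    rw [List.mem_zipIdx_iff_getElem?]
    exact List.getElem?_idxOf (hmem i n)
  have hget : ∀ i n, W.getD (W.idxOf (w i n)) [] = w i n := by
    intro i n
    have := List.getElem?_idxOf (hmem i n)
    rw [List.getD_eq_getElem?_getD, this, Option.getD_some]
  have hlen : ∀ i n, (w i n).length = if J (r n) then 2 else 1 := fun i n => length_segment _ _ _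
  have hhead : ∀ i n, (w i n).head? = some (x i (r n)) := by
    intro i n
    simp only [hw]
    split_ifs <;> simp [segment, List.range_succ]
  have hlast : ∀ i n, (w i n).getLast? = some (x i (r (n + 1) - 1)) := by
    intro i n
    rw [hr₂ n]
    simp only [hw]
    split_ifs <;> simp [segment, List.range_succ]
    congr 1; ring
  refine ⟨fun i n => W.idxOf (w i n), r, fun i n => ⟨?_, ?_⟩, fun i => ⟨fun n => ⟨?_, ?_⟩, ?_⟩⟩
  · refine h.side _ (hx i (r n)).1 rfl _ (hzip i n) (hhead i n) _ (hzip (i + 1) n)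
      (hhead (i + 1) n) ((hlen _ _).trans (hlen _ _).symm) ?_
    intro q hq
    obtain ⟨k, hk, rfl⟩ := List.getElem_of_mem hq
    simp only [hw, List.getElem_zip, getElem_segment]
    exact (hx i _).1
  · have := (hx i (r (n + 1) - 1)).2
    rw [sub_add_cancel] at this
    exact h.next _ this rfl _ (hzip i n) (hlast i n) _ (hzip i (n + 1)) (hhead i (n + 1))
  · simp only [hget, hlen, hr₂ n]
    split_ifs <;> rfl
  · simp only [hget, hlen]
    rfl
  · intro n
    simp only [hget]
    intro h0
    have := hlen i n
    rw [h0] at this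
    split_ifs at this

/-- For some tiling by `D`, the words that `ρ` assigns to the letters are the same along each row,
and `s` is their concatenation. -/
def Coded (ρ : ℕ → List ℕ) (D : List Domino) (s : ℤ → ℕ) : Prop :=
  ∃ x r, IsTiling 0 1 D x ∧ ∀ i, Expands ρ r (x i) s

theorem Coded.merge_rows {up : Bool} {M : List ℕ} {W : List (List ℕ)} {D E R : List Domino}
    (h : IsMerging up 0 1 M W D (R ++ E)) (hR : Removable R E) {ρ : ℕ → List ℕ} {s : ℤ → ℕ}
    (hs : Coded ρ D s) : Coded (fun k => (W.getD k []).flatMap ρ) E s := by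
  obtain ⟨x, r, hx, hr⟩ := hs
  obtain ⟨y, q, hy, hq⟩ := h.exists_expands hx
  exact ⟨y, r ∘ q, hy.of_removable hR, fun i => (hq i).1.comp (hr i)⟩

/-- The words given by `ρ` agree along each row, so a block may be read off its first letter, and
the cuts of `s` do not change. -/
theorem Coded.merge_columns {up : Bool} {M : List ℕ} {W : List (List ℕ)} {D E R : List Domino}
    (h : IsMerging up 1 0 M W D (R ++ E)) (hR : Removable R E) {ρ : ℕ → List ℕ} {s : ℤ → ℕ}
    (hs : Coded ρ D s) : Coded (fun k => ρ ((W.getD k []).headD 0)) E s := by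
  obtain ⟨x, r, hx, hr⟩ := hs
  obtain ⟨y, q, hy, hq⟩ := h.exists_expands hx.transpose
  refine ⟨fun i j => y j i, r, hy.transpose.of_removable hR, fun i j => ?_⟩
  -- The default value 0 is never reached, because the blocks that occur are nonempty.
  have e : (W.getD (y j i) []).headD 0 = x (q i) j := by
    obtain ⟨h₁, h₂⟩ := (hq j).1 i
    have h₃ := (hq j).2 i
    dsimp only at h₂
    obtain ⟨a, l, hl⟩ := List.exists_cons_of_ne_nil h₃
    rw [hl] at h₂ ⊢
    have := congrArg List.head? h₂
    simp only [segment, List.length_cons, List.range_succ_eq_map, List.map_cons, List.head?_cons,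
      Nat.cast_zero, add_zero, Option.some.injEq] at this
    exact this.symm
  simp only [e]
  exact hr (q i) j

theorem Coded.congr {ρ ρ' : ℕ → List ℕ} {D : List Domino} {s : ℤ → ℕ} (hs : Coded ρ D s)
    (h : ∀ p ∈ D, ρ p.2.1 = ρ' p.2.1) : Coded ρ' D s := by
  obtain ⟨x, r, hx, hr⟩ := hs
  refine ⟨x, r, hx, fun i j => ?_⟩
  rw [← h _ (hx i j).1]
  exact hr i j

/-- When the code factors through a type `τ` that is constant along rows, the row types form an
intermediate sequence `t`, itself coded by the same tiling. -/
theorem Coded.exists_expands {f : ℕ → List ℕ} {τ : ℕ → ℕ} {D : List Domino} {s : ℤ → ℕ}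
    (hs : Coded (fun k => f (τ k)) D s) (h : ∀ p ∈ D, p.1 = 0 → τ p.2.1 = τ p.2.2) :
    ∃ t r, Coded (fun k => [τ k]) D t ∧ Expands f r t s := by
  obtain ⟨x, r, hx, hr⟩ := hs
  have hrow : ∀ i j, τ (x i j) = τ (x 0 j) := fun i j =>
    (hx.iff_of_fst (P := fun a => τ a = τ (x 0 j))
      (fun p hp hp' => by rw [h p hp hp']) i 0 j).2 rfl
  refine ⟨fun j => τ (x 0 j), r, ⟨x, id, hx, fun i j => ⟨by simp, ?_⟩⟩, hr 0⟩
  simp [segment, hrow i j]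

/-! ## The dominoes -/

/-- Matching pairs of tiles of `tiles₅` that occur in no tiling. -/
def wangRemoved : List Domino :=
  [(1, 22, 5), (1, 12, 5), (1, 4, 6), (1, 3, 1), (1, 28, 9), (1, 24, 12), (1, 24, 8),
    (1, 24, 7), (1, 22, 25), (1, 17, 24), (1, 15, 23), (1, 15, 17), (1, 15, 16), (1, 14, 8),
    (1, 14, 7), (1, 11, 20), (1, 10, 0), (1, 8, 10), (1, 7, 2), (1, 5, 23), (1, 5, 17),
    (1, 5, 16), (1, 4, 12), (1, 4, 11), (1, 4, 8), (1, 4, 7), (1, 2, 15), (1, 2, 14),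
    (1, 0, 19), (1, 0, 18), (1, 0, 17), (1, 0, 16), (0, 22, 13), (0, 20, 17), (1, 28, 25),
    (1, 28, 24), (1, 28, 5), (1, 28, 4), (1, 28, 3), (1, 27, 27), (1, 27, 25), (1, 27, 10),
    (1, 27, 9), (1, 27, 4), (1, 26, 25), (1, 26, 24), (1, 26, 5), (1, 26, 4), (1, 26, 3),
    (1, 25, 28), (1, 25, 12), (1, 25, 11), (1, 24, 28), (1, 24, 11), (1, 23, 27), (1, 23, 10),
    (1, 23, 9), (1, 23, 4), (1, 23, 3), (1, 22, 27), (1, 22, 10), (1, 22, 9), (1, 22, 4),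
    (1, 21, 22), (1, 21, 21), (1, 21, 20), (1, 21, 2), (1, 20, 22), (1, 20, 21), (1, 20, 20),
    (1, 20, 15), (1, 20, 13), (1, 20, 2), (1, 19, 25), (1, 19, 24), (1, 19, 9), (1, 19, 5),
    (1, 19, 3), (1, 18, 21), (1, 18, 20), (1, 18, 15), (1, 18, 14), (1, 18, 13), (1, 18, 0),
    (1, 17, 27), (1, 17, 10), (1, 17, 9), (1, 17, 4), (1, 17, 3), (1, 16, 22), (1, 16, 15),
    (1, 16, 14), (1, 16, 13), (1, 16, 2), (1, 16, 0), (1, 13, 18), (1, 13, 16), (1, 12, 27),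
    (1, 12, 10), (1, 12, 9), (1, 12, 4), (1, 12, 3), (1, 11, 22), (1, 11, 15), (1, 11, 14),
    (1, 11, 13), (1, 11, 2), (1, 11, 0), (1, 10, 22), (1, 10, 21), (1, 10, 20), (1, 10, 2),
    (1, 9, 22), (1, 9, 21), (1, 9, 20), (1, 9, 15), (1, 9, 13), (1, 9, 2), (1, 9, 0),
    (1, 8, 25), (1, 8, 24), (1, 8, 9), (1, 8, 5), (1, 8, 4), (1, 8, 3), (1, 7, 21), (1, 7, 20),
    (1, 7, 15), (1, 7, 14), (1, 7, 13), (1, 7, 0), (1, 6, 22), (1, 6, 15), (1, 6, 14),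
    (1, 6, 13), (1, 6, 2), (1, 6, 0), (1, 5, 1), (1, 2, 22), (1, 2, 21), (1, 2, 20), (1, 2, 2),
    (1, 2, 0), (1, 1, 22), (1, 1, 21), (1, 1, 20), (1, 1, 15), (1, 1, 13), (1, 1, 2), (1, 1, 0),
    (1, 0, 1), (0, 24, 22), (0, 23, 28), (0, 4, 0), (0, 3, 2), (0, 1, 12)]

/-- The other matching pairs of tiles of `tiles₅`. -/
def wangDominoes : List Domino :=
  [(0, 0, 2), (0, 0, 10), (0, 1, 0), (0, 2, 11), (0, 3, 10), (0, 4, 12), (0, 5, 1), (0, 5, 9),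
    (0, 6, 5), (0, 7, 4), (0, 8, 4), (0, 9, 8), (0, 10, 6), (0, 10, 7), (0, 11, 3), (0, 12, 3),
    (0, 13, 21), (0, 14, 22), (0, 14, 23), (0, 14, 27), (0, 15, 20), (0, 16, 15), (0, 17, 15),
    (0, 18, 14), (0, 19, 14), (0, 20, 19), (0, 21, 16), (0, 21, 18), (0, 22, 28), (0, 23, 13),
    (0, 24, 23), (0, 24, 27), (0, 25, 17), (0, 25, 19), (0, 26, 25), (0, 27, 26), (0, 28, 24),
    (1, 0, 23), (1, 1, 14), (1, 2, 13), (1, 3, 16), (1, 3, 17), (1, 3, 18), (1, 3, 19),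
    (1, 3, 23), (1, 4, 26), (1, 4, 28), (1, 5, 18), (1, 5, 19), (1, 6, 20), (1, 6, 21),
    (1, 7, 22), (1, 8, 27), (1, 9, 14), (1, 10, 13), (1, 10, 14), (1, 10, 15), (1, 11, 21),
    (1, 12, 24), (1, 12, 25), (1, 13, 1), (1, 13, 17), (1, 13, 19), (1, 13, 23), (1, 14, 6),
    (1, 14, 11), (1, 14, 12), (1, 14, 26), (1, 14, 28), (1, 15, 1), (1, 15, 18), (1, 15, 19),
    (1, 16, 20), (1, 16, 21), (1, 17, 5), (1, 17, 25), (1, 18, 2), (1, 18, 22), (1, 19, 4),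
    (1, 19, 10), (1, 19, 27), (1, 20, 0), (1, 20, 14), (1, 21, 0), (1, 21, 13), (1, 21, 14),
    (1, 21, 15), (1, 22, 3), (1, 22, 24), (1, 23, 5), (1, 23, 24), (1, 23, 25), (1, 24, 6),
    (1, 24, 26), (1, 25, 6), (1, 25, 7), (1, 25, 8), (1, 25, 26), (1, 26, 9), (1, 26, 10),
    (1, 26, 27), (1, 27, 3), (1, 27, 5), (1, 27, 24), (1, 28, 10), (1, 28, 27)]

/-- The dominoes of the sheared tilings. -/
def shearedDominoes : List Domino :=
  [(0, 0, 2), (0, 0, 10), (0, 1, 0), (0, 2, 11), (0, 3, 10), (0, 4, 12), (0, 5, 1), (0, 5, 9),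
    (0, 6, 5), (0, 7, 4), (0, 8, 4), (0, 9, 8), (0, 10, 6), (0, 10, 7), (0, 11, 3), (0, 12, 3),
    (0, 13, 21), (0, 14, 22), (0, 14, 23), (0, 14, 27), (0, 15, 20), (0, 16, 15), (0, 17, 15),
    (0, 18, 14), (0, 19, 14), (0, 20, 19), (0, 21, 16), (0, 21, 18), (0, 22, 28), (0, 23, 13),
    (0, 24, 23), (0, 24, 27), (0, 25, 17), (0, 25, 19), (0, 26, 25), (0, 27, 26), (0, 28, 24),
    (1, 0, 13), (1, 1, 23), (1, 2, 21), (1, 3, 13), (1, 3, 14), (1, 3, 15), (1, 4, 24),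
    (1, 4, 25), (1, 5, 14), (1, 6, 18), (1, 6, 19), (1, 7, 28), (1, 8, 26), (1, 9, 27),
    (1, 10, 20), (1, 10, 21), (1, 10, 22), (1, 11, 16), (1, 11, 18), (1, 12, 17), (1, 12, 19),
    (1, 12, 23), (1, 13, 0), (1, 13, 13), (1, 13, 14), (1, 13, 15), (1, 14, 3), (1, 14, 5),
    (1, 14, 24), (1, 14, 25), (1, 15, 0), (1, 15, 14), (1, 16, 18), (1, 16, 19), (1, 17, 1),
    (1, 17, 19), (1, 18, 11), (1, 18, 28), (1, 19, 6), (1, 19, 12), (1, 19, 26), (1, 20, 10),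
    (1, 20, 27), (1, 21, 2), (1, 21, 20), (1, 21, 21), (1, 21, 22), (1, 22, 10), (1, 22, 27),
    (1, 23, 1), (1, 23, 17), (1, 23, 19), (1, 23, 23), (1, 24, 5), (1, 24, 25), (1, 25, 4),
    (1, 25, 5), (1, 25, 25), (1, 26, 6), (1, 26, 7), (1, 26, 8), (1, 26, 26), (1, 27, 9),
    (1, 27, 10), (1, 27, 27), (1, 28, 6), (1, 28, 26)]

/-- The letters filling the rows to be merged with the preceding ones. -/
def shearedMarked : List ℕ :=
  [0, 1, 2, 3, 4, 5, 6, 7, 8, 9, 10, 11, 12]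

/-- The letters of the next alphabet, as blocks of letters of the present one. -/
def shearedBlocks : List (List ℕ) :=
  [[13], [14], [15], [16], [17], [18], [19], [20], [21], [22], [23], [24], [25], [26], [27],
    [28], [13, 0], [14, 3], [14, 5], [15, 0], [17, 1], [18, 11], [19, 6], [19, 12], [20, 10],
    [21, 2], [22, 10], [23, 1], [24, 5], [25, 4], [25, 5], [26, 6], [26, 7], [26, 8], [27, 9],
    [27, 10], [28, 6]]

/-- Dominoes of the next alphabet that occur in no tiling. -/
def shearedRemoved : List Domino :=
  [(1, 3, 5), (1, 8, 8), (1, 0, 0), (1, 10, 10), (1, 1, 11), (1, 18, 18), (1, 5, 15),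
    (1, 22, 22), (1, 22, 6), (1, 13, 32), (1, 11, 30), (1, 11, 12), (1, 8, 9), (1, 0, 1),
    (1, 36, 23), (1, 35, 25), (1, 31, 23), (1, 31, 21), (1, 30, 17), (1, 26, 26), (1, 26, 9),
    (1, 24, 26), (1, 24, 24), (1, 24, 9), (1, 24, 7), (1, 23, 22), (1, 23, 6), (1, 22, 23),
    (1, 17, 18), (1, 15, 32), (1, 15, 31), (1, 15, 13), (1, 14, 35), (1, 14, 14), (1, 13, 31),
    (1, 13, 13), (1, 12, 30), (1, 12, 12), (1, 10, 22), (1, 10, 6), (1, 9, 35), (1, 9, 14),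
    (1, 4, 22), (1, 4, 6), (1, 3, 23), (1, 0, 18), (0, 12, 6), (0, 11, 14)]

/-- The other dominoes of the next alphabet. -/
def stackedDominoes : List Domino :=
  [(0, 0, 8), (0, 1, 9), (0, 1, 10), (0, 1, 14), (0, 2, 7), (0, 3, 2), (0, 4, 2), (0, 5, 1),
    (0, 6, 1), (0, 7, 6), (0, 8, 3), (0, 8, 5), (0, 9, 15), (0, 10, 0), (0, 11, 10), (0, 12, 4),
    (0, 13, 12), (0, 14, 13), (0, 15, 11), (0, 16, 25), (0, 17, 26), (0, 17, 35), (0, 18, 27),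
    (0, 18, 34), (0, 19, 24), (0, 20, 19), (0, 21, 17), (0, 22, 18), (0, 23, 17), (0, 24, 22),
    (0, 25, 21), (0, 26, 36), (0, 27, 16), (0, 28, 27), (0, 28, 34), (0, 29, 23), (0, 30, 20),
    (0, 31, 30), (0, 32, 29), (0, 33, 29), (0, 34, 33), (0, 35, 31), (0, 35, 32), (0, 36, 28),
    (1, 0, 2), (1, 0, 16), (1, 0, 17), (1, 0, 19), (1, 1, 12), (1, 1, 28), (1, 1, 29),
    (1, 1, 30), (1, 2, 1), (1, 2, 17), (1, 2, 18), (1, 3, 6), (1, 3, 21), (1, 3, 22),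
    (1, 4, 23), (1, 5, 36), (1, 6, 13), (1, 6, 31), (1, 6, 32), (1, 6, 33), (1, 7, 14),
    (1, 7, 34), (1, 7, 35), (1, 8, 7), (1, 8, 24), (1, 8, 25), (1, 8, 26), (1, 9, 34),
    (1, 10, 4), (1, 10, 20), (1, 10, 23), (1, 10, 27), (1, 11, 29), (1, 12, 29), (1, 13, 33),
    (1, 14, 34), (1, 15, 33), (1, 16, 0), (1, 16, 16), (1, 17, 0), (1, 17, 1), (1, 17, 2),
    (1, 17, 16), (1, 17, 17), (1, 17, 19), (1, 18, 1), (1, 18, 17), (1, 19, 0), (1, 19, 16),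
    (1, 20, 10), (1, 20, 27), (1, 21, 3), (1, 21, 5), (1, 21, 21), (1, 22, 5), (1, 22, 21),
    (1, 23, 4), (1, 23, 10), (1, 23, 20), (1, 23, 23), (1, 23, 27), (1, 24, 8), (1, 24, 25),
    (1, 25, 8), (1, 25, 25), (1, 26, 7), (1, 26, 8), (1, 26, 24), (1, 26, 25), (1, 27, 10),
    (1, 27, 27), (1, 28, 1), (1, 28, 17), (1, 28, 18), (1, 29, 11), (1, 29, 12), (1, 29, 28),
    (1, 29, 29), (1, 29, 30), (1, 30, 1), (1, 30, 18), (1, 31, 5), (1, 31, 6), (1, 31, 22),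
    (1, 32, 15), (1, 32, 36), (1, 33, 13), (1, 33, 31), (1, 33, 32), (1, 33, 33), (1, 34, 14),
    (1, 34, 34), (1, 34, 35), (1, 35, 7), (1, 35, 8), (1, 35, 9), (1, 35, 24), (1, 35, 26),
    (1, 36, 5), (1, 36, 6), (1, 36, 21), (1, 36, 22)]

/-- The letters filling the columns to be merged with the following ones. -/
def stackedMarked : List ℕ :=
  [4, 7, 8, 9, 10, 14, 20, 23, 24, 25, 26, 27, 34, 35]

/-- The letters of the next alphabet, as blocks of letters of the present one. -/
def stackedBlocks : List (List ℕ) :=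
  [[1], [2], [11], [12], [17], [18], [28], [29], [30], [4, 2], [7, 6], [8, 3], [8, 5], [9, 15],
    [10, 0], [14, 13], [20, 19], [23, 17], [24, 22], [25, 21], [26, 36], [27, 16], [34, 33],
    [35, 31], [35, 32]]

/-- Dominoes of the next alphabet that occur in no tiling. -/
def stackedRemoved : List Domino :=
  []

/-- The dominoes of the self-similar tilings. -/
def coreDominoes : List Domino :=
  [(0, 0, 13), (0, 0, 14), (0, 0, 15), (0, 1, 10), (0, 2, 14), (0, 3, 9), (0, 4, 20),
    (0, 4, 23), (0, 4, 24), (0, 5, 21), (0, 5, 22), (0, 6, 21), (0, 6, 22), (0, 7, 17),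
    (0, 8, 16), (0, 9, 10), (0, 10, 0), (0, 11, 1), (0, 12, 0), (0, 13, 2), (0, 14, 11),
    (0, 14, 12), (0, 15, 3), (0, 16, 18), (0, 17, 20), (0, 17, 23), (0, 17, 24), (0, 18, 5),
    (0, 19, 4), (0, 20, 6), (0, 21, 19), (0, 22, 7), (0, 23, 8), (0, 24, 7), (1, 0, 3),
    (1, 0, 6), (1, 0, 7), (1, 0, 8), (1, 1, 0), (1, 1, 4), (1, 1, 5), (1, 2, 7), (1, 3, 7),
    (1, 4, 0), (1, 4, 1), (1, 4, 4), (1, 5, 0), (1, 5, 4), (1, 6, 0), (1, 6, 4), (1, 6, 5),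
    (1, 7, 2), (1, 7, 3), (1, 7, 6), (1, 7, 7), (1, 7, 8), (1, 8, 0), (1, 8, 5), (1, 9, 17),
    (1, 10, 15), (1, 10, 22), (1, 10, 23), (1, 10, 24), (1, 11, 10), (1, 11, 18), (1, 11, 19),
    (1, 12, 20), (1, 13, 22), (1, 14, 9), (1, 14, 16), (1, 14, 17), (1, 14, 21), (1, 15, 22),
    (1, 16, 14), (1, 16, 21), (1, 17, 9), (1, 17, 14), (1, 17, 16), (1, 17, 17), (1, 17, 21),
    (1, 18, 12), (1, 18, 19), (1, 19, 11), (1, 19, 12), (1, 19, 19), (1, 20, 10), (1, 20, 12),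
    (1, 20, 18), (1, 20, 19), (1, 21, 14), (1, 21, 21), (1, 22, 15), (1, 22, 22), (1, 22, 23),
    (1, 22, 24), (1, 23, 10), (1, 23, 12), (1, 23, 18), (1, 24, 13), (1, 24, 20)]

/-- The letters filling the columns to be merged with the following ones. -/
def coreMarked : List ℕ :=
  [0, 1, 2, 3, 4, 5, 6, 7, 8]

/-- The letters of the next alphabet, as blocks of letters of the present one. -/
def coreBlocks : List (List ℕ) :=
  [[10], [11], [12], [18], [19], [20], [23], [24], [0, 13], [0, 14], [0, 15], [1, 10], [2, 14],
    [3, 9], [4, 20], [4, 23], [4, 24], [5, 21], [5, 22], [6, 21], [6, 22], [7, 17], [8, 16]]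

/-- Dominoes of the next alphabet that occur in no tiling. -/
def coreRemoved : List Domino :=
  [(1, 11, 10), (1, 9, 13), (1, 1, 0), (0, 14, 20), (0, 12, 1), (0, 11, 10), (0, 11, 8),
    (0, 0, 10), (0, 0, 8)]

/-- The other dominoes of the next alphabet. -/
def mergedDominoes : List Domino :=
  [(0, 0, 9), (0, 1, 11), (0, 2, 8), (0, 2, 9), (0, 2, 10), (0, 3, 17), (0, 3, 18), (0, 4, 14),
    (0, 4, 15), (0, 4, 16), (0, 5, 19), (0, 5, 20), (0, 6, 22), (0, 7, 21), (0, 8, 12),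
    (0, 9, 1), (0, 9, 2), (0, 10, 13), (0, 11, 9), (0, 12, 2), (0, 13, 0), (0, 14, 19),
    (0, 15, 22), (0, 16, 21), (0, 17, 4), (0, 18, 21), (0, 19, 4), (0, 20, 21), (0, 21, 5),
    (0, 21, 6), (0, 21, 7), (0, 22, 3), (1, 0, 6), (1, 0, 7), (1, 1, 3), (1, 1, 4), (1, 2, 5),
    (1, 3, 2), (1, 3, 4), (1, 4, 1), (1, 4, 2), (1, 4, 4), (1, 5, 0), (1, 5, 2), (1, 5, 3),
    (1, 5, 4), (1, 6, 0), (1, 6, 2), (1, 6, 3), (1, 7, 5), (1, 8, 20), (1, 9, 19), (1, 9, 21),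
    (1, 9, 22), (1, 10, 20), (1, 11, 15), (1, 11, 16), (1, 11, 18), (1, 12, 21), (1, 13, 21),
    (1, 14, 11), (1, 15, 11), (1, 16, 8), (1, 16, 14), (1, 17, 9), (1, 18, 10), (1, 18, 15),
    (1, 18, 16), (1, 19, 9), (1, 19, 17), (1, 20, 10), (1, 20, 15), (1, 20, 16), (1, 20, 18),
    (1, 21, 12), (1, 21, 13), (1, 21, 19), (1, 21, 21), (1, 21, 22), (1, 22, 9), (1, 22, 17)]

/-- The letters filling the rows to be merged with the following ones. -/
def mergedMarked : List ℕ :=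
  [0, 1, 2, 8, 9, 10, 11, 12, 13]

/-- The letters of the next alphabet, as blocks of letters of the present one. -/
def mergedBlocks : List (List ℕ) :=
  [[3], [4], [5], [14], [15], [16], [17], [18], [19], [21], [22], [0, 6], [0, 7], [1, 3],
    [1, 4], [2, 5], [8, 20], [9, 19], [9, 21], [9, 22], [10, 20], [11, 15], [11, 16], [11, 18],
    [12, 21], [13, 21]]

/-- Dominoes of the next alphabet that occur in no tiling. -/
def mergedRemoved : List Domino :=
  [(1, 8, 6), (1, 2, 0), (1, 1, 1), (1, 16, 7), (1, 16, 5), (1, 11, 15), (1, 11, 11),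
    (1, 9, 10), (1, 7, 5), (1, 7, 4), (1, 5, 3), (1, 4, 21), (1, 0, 1), (1, 25, 24), (1, 25, 8),
    (1, 24, 24), (1, 24, 9), (1, 24, 8), (1, 23, 5), (1, 21, 21), (1, 19, 19), (1, 19, 17),
    (1, 18, 9), (1, 10, 19), (1, 10, 17), (1, 10, 6), (1, 9, 9), (1, 9, 8), (1, 6, 19),
    (1, 6, 18), (1, 2, 1)]

/-- The other dominoes of the next alphabet. -/
def pairedDominoes : List Domino :=
  [(0, 0, 6), (0, 0, 7), (0, 1, 3), (0, 1, 4), (0, 1, 5), (0, 2, 8), (0, 3, 8), (0, 4, 10),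
    (0, 5, 9), (0, 6, 1), (0, 7, 9), (0, 8, 1), (0, 9, 2), (0, 10, 0), (0, 11, 19), (0, 12, 18),
    (0, 13, 23), (0, 14, 21), (0, 14, 22), (0, 15, 16), (0, 15, 17), (0, 15, 20), (0, 16, 24),
    (0, 17, 14), (0, 18, 15), (0, 19, 13), (0, 20, 25), (0, 21, 19), (0, 22, 18), (0, 23, 18),
    (0, 24, 15), (0, 25, 11), (0, 25, 12), (1, 0, 15), (1, 1, 13), (1, 1, 14), (1, 1, 15),
    (1, 2, 11), (1, 2, 12), (1, 2, 15), (1, 3, 21), (1, 3, 22), (1, 3, 23), (1, 4, 22),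
    (1, 4, 23), (1, 5, 16), (1, 6, 17), (1, 7, 20), (1, 8, 17), (1, 8, 18), (1, 8, 19),
    (1, 9, 24), (1, 9, 25), (1, 10, 18), (1, 11, 0), (1, 11, 12), (1, 12, 2), (1, 13, 1),
    (1, 13, 15), (1, 14, 1), (1, 14, 13), (1, 14, 14), (1, 14, 15), (1, 15, 0), (1, 15, 1),
    (1, 15, 11), (1, 15, 12), (1, 15, 15), (1, 16, 4), (1, 16, 20), (1, 17, 6), (1, 17, 17),
    (1, 17, 18), (1, 17, 19), (1, 18, 8), (1, 18, 10), (1, 18, 24), (1, 18, 25), (1, 19, 6),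
    (1, 19, 18), (1, 20, 4), (1, 20, 5), (1, 20, 7), (1, 20, 20), (1, 21, 22), (1, 21, 23),
    (1, 22, 3), (1, 22, 16), (1, 23, 4), (1, 23, 20), (1, 24, 10), (1, 24, 25), (1, 25, 9),
    (1, 25, 10), (1, 25, 25)]

/-- The letters filling the rows to be merged with the preceding ones. -/
def pairedMarked : List ℕ :=
  [0, 1, 2, 3, 4, 5, 6, 7, 8, 9, 10]

/-- The letters of the next alphabet, as blocks of letters of the present one. -/
def pairedBlocks : List (List ℕ) :=
  [[11], [13], [14], [15], [16], [17], [18], [19], [20], [21], [22], [23], [24], [25], [11, 0],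
    [12, 2], [13, 1], [14, 1], [15, 0], [15, 1], [16, 4], [17, 6], [18, 8], [18, 10], [19, 6],
    [20, 4], [20, 5], [20, 7], [22, 3], [23, 4], [24, 10], [25, 9], [25, 10]]

/-- Dominoes of the next alphabet that occur in no tiling. -/
def pairedRemoved : List Domino :=
  [(1, 9, 10), (1, 2, 2), (1, 12, 13), (1, 5, 5), (1, 4, 8), (1, 3, 3), (1, 6, 12), (1, 25, 28),
    (1, 23, 23), (1, 10, 4), (1, 8, 8), (1, 2, 3), (1, 32, 22), (1, 29, 29), (1, 29, 11),
    (1, 28, 29), (1, 28, 11), (1, 22, 23), (1, 19, 18), (1, 17, 19), (1, 17, 18), (1, 17, 16),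
    (1, 17, 3), (1, 17, 1), (1, 16, 19), (1, 16, 18), (1, 16, 16), (1, 16, 3), (1, 16, 1),
    (1, 15, 19), (1, 14, 19), (1, 13, 32), (1, 13, 13), (1, 12, 32), (1, 8, 26), (1, 8, 25),
    (1, 5, 23), (1, 5, 6), (1, 4, 26), (1, 4, 25), (1, 3, 19), (1, 2, 18)]

/-- The other dominoes of the next alphabet. -/
def tallDominoes : List Domino :=
  [(0, 0, 7), (0, 1, 11), (0, 2, 9), (0, 2, 10), (0, 3, 4), (0, 3, 5), (0, 3, 8), (0, 4, 12),
    (0, 5, 2), (0, 6, 3), (0, 7, 1), (0, 8, 13), (0, 9, 7), (0, 10, 6), (0, 11, 6), (0, 12, 3),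
    (0, 13, 0), (0, 14, 24), (0, 15, 22), (0, 16, 29), (0, 17, 28), (0, 18, 21), (0, 18, 27),
    (0, 19, 20), (0, 19, 25), (0, 19, 26), (0, 20, 30), (0, 21, 17), (0, 22, 19), (0, 23, 18),
    (0, 24, 16), (0, 25, 32), (0, 26, 31), (0, 27, 31), (0, 28, 22), (0, 29, 23), (0, 30, 18),
    (0, 31, 15), (0, 32, 14), (1, 0, 15), (1, 1, 3), (1, 1, 18), (1, 1, 19), (1, 2, 1),
    (1, 2, 16), (1, 2, 17), (1, 2, 19), (1, 3, 0), (1, 3, 14), (1, 3, 15), (1, 3, 18),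
    (1, 4, 27), (1, 5, 7), (1, 5, 21), (1, 5, 22), (1, 5, 24), (1, 6, 13), (1, 6, 30),
    (1, 6, 31), (1, 6, 32), (1, 7, 6), (1, 7, 22), (1, 7, 23), (1, 8, 27), (1, 9, 11),
    (1, 9, 28), (1, 9, 29), (1, 10, 20), (1, 11, 8), (1, 11, 25), (1, 11, 26), (1, 11, 27),
    (1, 12, 31), (1, 13, 31), (1, 14, 3), (1, 14, 18), (1, 15, 0), (1, 15, 3), (1, 15, 14),
    (1, 15, 15), (1, 15, 18), (1, 16, 2), (1, 16, 17), (1, 17, 2), (1, 17, 17), (1, 18, 3),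
    (1, 18, 18), (1, 18, 19), (1, 19, 1), (1, 19, 2), (1, 19, 3), (1, 19, 16), (1, 19, 17),
    (1, 19, 19), (1, 20, 10), (1, 20, 11), (1, 20, 28), (1, 20, 29), (1, 21, 5), (1, 21, 21),
    (1, 22, 5), (1, 22, 6), (1, 22, 7), (1, 22, 21), (1, 22, 22), (1, 22, 24), (1, 23, 6),
    (1, 23, 22), (1, 24, 5), (1, 24, 21), (1, 25, 10), (1, 25, 11), (1, 25, 29), (1, 26, 4),
    (1, 26, 20), (1, 27, 8), (1, 27, 25), (1, 27, 26), (1, 27, 27), (1, 28, 9), (1, 28, 10),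
    (1, 28, 28), (1, 29, 10), (1, 29, 28), (1, 30, 6), (1, 30, 22), (1, 30, 23), (1, 31, 12),
    (1, 31, 13), (1, 31, 30), (1, 31, 31), (1, 31, 32), (1, 32, 6), (1, 32, 23)]

/-- The letters filling the columns to be merged with the following ones. -/
def tallMarked : List ℕ :=
  [0, 1, 2, 3, 14, 15, 16, 17, 18, 19]

/-- The letters of the next alphabet, as blocks of letters of the present one. -/
def tallBlocks : List (List ℕ) :=
  [[6], [7], [12], [13], [22], [23], [30], [31], [32], [0, 7], [1, 11], [2, 9], [2, 10], [3, 4],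
    [3, 5], [3, 8], [14, 24], [15, 22], [16, 29], [17, 28], [19, 20], [18, 21], [18, 27],
    [19, 25], [19, 26]]

/-- Dominoes of the next alphabet that occur in no tiling. -/
def tallRemoved : List Domino :=
  [(0, 2, 15), (0, 2, 13)]

/-! ### Verification of the six mergings and of the removals -/

theorem stacked_isMerging : IsMerging true 0 1 shearedMarked shearedBlocks shearedDominoes
    (shearedRemoved ++ stackedDominoes) := by decide +kernel

theorem stacked_removable : Removable shearedRemoved stackedDominoes := by decide +kernel

theorem core_isMerging : IsMerging false 1 0 stackedMarked stackedBlocks stackedDominoes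
    (stackedRemoved ++ coreDominoes) := by decide +kernel

theorem merged_isMerging : IsMerging false 1 0 coreMarked coreBlocks coreDominoes
    (coreRemoved ++ mergedDominoes) := by decide +kernel

theorem merged_removable : Removable coreRemoved mergedDominoes := by decide +kernel

theorem paired_isMerging : IsMerging false 0 1 mergedMarked mergedBlocks mergedDominoes
    (mergedRemoved ++ pairedDominoes) := by decide +kernel

theorem paired_removable : Removable mergedRemoved pairedDominoes := by decide +kernel

theorem tall_isMerging : IsMerging true 0 1 pairedMarked pairedBlocks pairedDominoes
    (pairedRemoved ++ tallDominoes) := by decide +kernel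

theorem tall_removable : Removable pairedRemoved tallDominoes := by decide +kernel

theorem core_isMerging_tall : IsMerging false 1 0 tallMarked tallBlocks tallDominoes
    (tallRemoved ++ coreDominoes) := by decide +kernel

theorem core_removable : Removable tallRemoved coreDominoes := by decide +kernel

theorem wang_removable : Removable wangRemoved wangDominoes := by decide +kernel

/-! ## Sequences of heights of the tilings by `tiles₅` -/

/-- The height of the column of Jeandel-Rao tiles that corresponds to a tile of `tiles₅`. -/
def tileHeight (k : ℕ) : ℕ := if k < 13 then 4 else 5

/-- The type of the row of a letter of the self-similar tilings. -/
def coreType (k : ℕ) : ℕ := if k < 4 ∨ 9 ≤ k ∧ k < 16 then 4 else 5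

/-- A substitution conjugate to the square of `fibSubst`. -/
def coreSubst (a : ℕ) : List ℕ := if a = 5 then [4, 5, 5] else [4, 5]

/-- The sequences of types of the rows of the self-similar tilings. -/
def IsCoreSequence (t : ℤ → ℕ) : Prop := Coded (fun k => [coreType k]) coreDominoes t

theorem coreType_eq : ∀ p ∈ coreDominoes, p.1 = 0 → coreType p.2.1 = coreType p.2.2 := by
  decide +kernel

/-- The four mergings close the cycle from `coreDominoes` to itself; the last computation checks
that the composed code of each letter is `coreSubst` of its type. -/
theorem IsCoreSequence.exists_expands {s : ℤ → ℕ} (h : IsCoreSequence s) :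
    ∃ t r, IsCoreSequence t ∧ Expands coreSubst r t s :=
  ((((h.merge_columns merged_isMerging merged_removable).merge_rows paired_isMerging
    paired_removable).merge_rows tall_isMerging tall_removable).merge_columns core_isMerging_tall
    core_removable).congr (ρ' := fun k => coreSubst (coreType k)) (by decide +kernel)
    |>.exists_expands coreType_eq

theorem isTiling_wang {x : Config (Fin 29)} (hx : x ∈ wangShift tiles₅) :
    IsTiling 0 1 wangDominoes fun i j => x (i, j) := by
  refine IsTiling.of_removable wang_removable fun i j => ?_
  have h₀ : ∀ a b : Fin 29, (tiles₅ a).right = (tiles₅ b).left →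
      (0, (a : ℕ), (b : ℕ)) ∈ wangRemoved ++ wangDominoes := by decide +kernel
  have h₁ : ∀ a b : Fin 29, (tiles₅ a).top = (tiles₅ b).bottom →
      (1, (a : ℕ), (b : ℕ)) ∈ wangRemoved ++ wangDominoes := by decide +kernel
  have := hx (i, j)
  simp only [Prod.mk_add_mk, add_zero] at this
  exact ⟨h₀ _ _ this.1, h₁ _ _ this.2⟩

-- A vertical domino of the sheared tiling is a diagonal of a 2×2 square of the original one, so
-- `h₁` runs over all such squares.
set_option synthInstance.maxHeartbeats 400000 in
set_option synthInstance.maxSize 1024 in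
theorem IsTiling.shear {x : ℤ → ℤ → ℕ} (hx : IsTiling 0 1 wangDominoes x) :
    IsTiling 0 1 shearedDominoes fun i j => x (i + j) j := by
  intro i j
  have h₀ : ∀ p ∈ wangDominoes, p.1 = 0 → p ∈ shearedDominoes := by decide +kernel
  have h₁ : ∀ p ∈ wangDominoes, p.1 = 0 → ∀ q ∈ wangDominoes, q.1 = 1 → q.2.1 = p.2.2 →
      ∀ p' ∈ wangDominoes, p'.1 = 1 → p'.2.1 = p.2.1 → (0, p'.2.2, q.2.2) ∈ wangDominoes →
        (1, p.2.1, q.2.2) ∈ shearedDominoes := by decide +kernel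
  refine ⟨?_, ?_⟩
  · have := h₀ _ (hx (i + j) j).1 rfl
    rwa [show i + j + 1 = i + 1 + j by ring] at this
  · have := h₁ _ (hx (i + j) j).1 rfl _ (hx (i + j + 1) j).2 rfl rfl
      _ (hx (i + j) j).2 rfl rfl (hx (i + j) (j + 1)).1
    rwa [add_assoc] at this

theorem tileHeight_eq : ∀ p ∈ wangDominoes, p.1 = 0 → tileHeight p.2.1 = tileHeight p.2.2 := by
  decide +kernel

theorem tileHeight_row {x : Config (Fin 29)} (hx : x ∈ wangShift tiles₅) (i j : ℤ) :
    tileHeight (x (i, j)) = tileHeight (x (0, j)) :=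
  ((isTiling_wang hx).iff_of_fst (P := fun a => tileHeight a = tileHeight (x (0, j)))
    (fun p hp hp' => by rw [tileHeight_eq p hp hp']) i 0 j).2 rfl

/-- Shearing slides each row along itself and keeps the height sequence. After two mergings, a core
row of type 4 stands for a row of height 5, and one of type 5 for a row of height 5 below a row of
height 4. -/
theorem exists_expands_fibSubst {x : Config (Fin 29)} (hx : x ∈ wangShift tiles₅) :
    ∃ t r, IsCoreSequence t ∧ Expands fibSubst r t fun j => tileHeight (x (0, j)) := by
  have h : Coded (fun k => [tileHeight k]) shearedDominoes fun j => tileHeight (x (0, j)) := by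
    refine ⟨_, id, (isTiling_wang hx).shear, fun i j => ⟨by simp, ?_⟩⟩
    simp [segment, tileHeight_row hx]
  exact ((h.merge_rows stacked_isMerging stacked_removable).merge_columns
    (R := stackedRemoved) core_isMerging trivial).congr
    (ρ' := fun k => fibSubst (coreType k)) (by decide +kernel)
    |>.exists_expands coreType_eq

/-! ## Factors of the Fibonacci word -/

theorem fibIter_add_two (n : ℕ) : fibIter (n + 2) = fibIter (n + 1) ++ fibIter n := by
  induction n with
  | zero => rfl
  | succ n ih =>
    change (fibIter (n + 2)).flatMap fibSubst = _
    conv_lhs => rw [ih, List.flatMap_append]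
    rfl

theorem mem_wordLanguage_fibWord {u : List ℕ} :
    u ∈ wordLanguage fibWord ↔ ∃ n, u <:+: fibIter n := by
  constructor
  · rintro ⟨n, hn⟩
    refine ⟨n + u.length, .trans ?_ (wordPrefix_isPrefix _).isInfix⟩
    rw [wordPrefix, List.range_add, List.map_append, List.map_map]
    conv_lhs => rw [hn]
    exact (List.suffix_append _ _).isInfix
  · rintro ⟨n, a, b, hab⟩
    refine ⟨a.length, ?_⟩
    have h := eq_wordPrefix_of_isPrefix (List.prefix_refl (fibIter n))
    rw [← hab] at h
    refine List.ext_getElem (by simp) fun k hk _ => ?_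
    have e : (a ++ u ++ b)[a.length + k]? = some u[k] := by
      rw [List.append_assoc, List.getElem?_append_right (by simp), Nat.add_sub_cancel_left,
        List.getElem?_append_left hk, List.getElem?_eq_getElem hk]
    have hlt : a.length + k < (a ++ u ++ b).length := by
      simp only [List.length_append]; omega
    rw [h, wordPrefix, List.getElem?_map, List.getElem?_range hlt] at e
    simpa using e.symm

/-- The finite factors of the Fibonacci word. -/
def IsFibFactor (u : List ℕ) : Prop := ∃ n, u <:+: fibIter n

theorem IsFibFactor.mono {u v : List ℕ} (hv : IsFibFactor v) (h : u <:+: v) : IsFibFactor u :=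
  hv.imp fun _ hn => h.trans hn

theorem flatMap_isInfix {A B : Type*} {f : A → List B} {u v : List A} (h : u <:+: v) :
    u.flatMap f <:+: v.flatMap f := by
  obtain ⟨a, b, rfl⟩ := h
  exact ⟨a.flatMap f, b.flatMap f, by simp⟩

theorem IsFibFactor.flatMap_fibSubst {u : List ℕ} (h : IsFibFactor u) :
    IsFibFactor (u.flatMap fibSubst) := by
  obtain ⟨n, hn⟩ := h
  exact ⟨n + 1, flatMap_isInfix hn⟩

/-- The letter 5 moves through the image letter by letter: 5·45 = 54·5 and 5·455 = 545·5. -/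
theorem cons_flatMap_coreSubst (u : List ℕ) :
    5 :: u.flatMap coreSubst = (u.flatMap fibSubst).flatMap fibSubst ++ [5] := by
  induction u with
  | nil => rfl
  | cons a u ih =>
    simp only [List.flatMap_cons, List.flatMap_append, List.append_assoc, ← ih]
    by_cases h : a = 5 <;> simp [h, coreSubst, fibSubst]

/-- `fibIter (n + 3)` is the double `fibSubst`-image of `fibIter n` followed by `fibIter (n + 1)`,
whose initial 5 is the one the conjugacy asks for. -/
theorem IsFibFactor.flatMap_coreSubst {u : List ℕ} (h : IsFibFactor u) :
    IsFibFactor (u.flatMap coreSubst) := by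
  obtain ⟨n, hn⟩ := h
  refine ⟨n + 3, (flatMap_isInfix hn).trans ?_⟩
  have h := cons_flatMap_coreSubst (fibIter n)
  obtain ⟨t, ht⟩ := fibIter_head (n + 1)
  rw [fibIter_add_two, ht]
  refine ⟨[5], t, ?_⟩
  rw [List.singleton_append, h, List.append_assoc, List.singleton_append]
  rfl

theorem two_le_length_coreSubst (a : ℕ) : 2 ≤ (coreSubst a).length := by
  unfold coreSubst; split <;> simp

/-- Induction on the length, over all core sequences at once: a factor of length `l` lies in the
image of `1 + l / 2` letters, which is fewer than `l` as soon as `l ≥ 3`. -/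
theorem IsFibFactor.of_isCoreSequence {t : ℤ → ℕ} (ht : IsCoreSequence t) (p : ℤ) (l : ℕ) :
    IsFibFactor (segment t p l) := by
  induction l using Nat.strong_induction_on generalizing t p with
  | _ l ih =>
    obtain ⟨t', r, ht', hr⟩ := ht.exists_expands
    obtain ⟨j, hj⟩ := hr.isInfix (k := 2) one_le_two (fun _ => two_le_length_coreSubst _) p l
      (l / 2) (by omega)
    refine IsFibFactor.mono ?_ hj
    by_cases hl : l < 3
    -- Nothing about the two letters is needed: even 44, which is not a Fibonacci factor, has the
    -- image 4545, which is one.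
    · have : IsFibFactor ((segment t' j 2).flatMap coreSubst) := by
        refine ⟨7, ?_⟩
        simp only [segment, List.range_succ, List.range_zero, List.nil_append, List.cons_append,
          List.map_cons, List.map_nil, List.flatMap_cons, List.flatMap_nil, List.append_nil,
          coreSubst]
        split_ifs <;> decide
      exact this.mono (flatMap_isInfix (segment_isInfix _ le_rfl (by omega)))
    · exact (ih _ (by omega) ht' j).flatMap_coreSubst

/-- The image of the letter before an occurrence of `fibIter (2 * n)` ends in 5. Together with the
image of that occurrence, this 5 yields `fibIter (2 * n + 2)` by conjugacy. -/
theorem IsCoreSequence.exists_fibIter_eq {t : ℤ → ℕ} (ht : IsCoreSequence t) (n : ℕ) :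
    ∃ p, fibIter (2 * n) = segment t p (fibIter (2 * n)).length := by
  induction n generalizing t with
  | zero =>
    obtain ⟨t', r, -, hr⟩ := ht.exists_expands
    refine exists_segment_of_isInfix (hr 0).2 ?_
    simp only [coreSubst]
    split_ifs <;> decide
  | succ n ih =>
    obtain ⟨t', r, ht', hr⟩ := ht.exists_expands
    obtain ⟨p, hp⟩ := ih ht'
    have h := hr.segment_eq (p - 1) (1 + (fibIter (2 * n)).length)
    rw [segment_add, Nat.cast_one, sub_add_cancel, ← hp] at h
    refine exists_segment_of_isInfix h.2 ?_
    rw [List.flatMap_append, segment_one, List.flatMap_singleton]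
    have e := cons_flatMap_coreSubst (fibIter (2 * n))
    obtain ⟨x, hx⟩ : ∃ x, coreSubst (t' (p - 1)) = x ++ [5] := by
      unfold coreSubst
      split_ifs
      exacts [⟨[4, 5], rfl⟩, ⟨[4], rfl⟩]
    rw [hx, List.append_assoc, List.singleton_append, e]
    exact ⟨x, [5], by simp [fibIter, Nat.mul_succ]⟩

theorem isFibFactor_segment_tileHeight {x : Config (Fin 29)} (hx : x ∈ wangShift tiles₅) (p : ℤ)
    (l : ℕ) : IsFibFactor (segment (fun j => tileHeight (x (0, j))) p l) := by
  obtain ⟨t, r, ht, hr⟩ := exists_expands_fibSubst hx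
  obtain ⟨j, hj⟩ := hr.isInfix le_rfl (fun j => by unfold fibSubst; split <;> simp) p l l
    (by omega)
  exact (IsFibFactor.of_isCoreSequence ht j _).flatMap_fibSubst.mono hj

theorem IsFibFactor.exists_segment_tileHeight {u : List ℕ} (hu : IsFibFactor u)
    {x : Config (Fin 29)} (hx : x ∈ wangShift tiles₅) :
    ∃ p, u = segment (fun j => tileHeight (x (0, j))) p u.length := by
  obtain ⟨n, hn⟩ := hu
  obtain ⟨t, r, ht, hr⟩ := exists_expands_fibSubst hx
  obtain ⟨p, hp⟩ := ht.exists_fibIter_eq n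
  have h := (hr.segment_eq p (fibIter (2 * n)).length).2
  rw [← hp] at h
  refine exists_segment_of_isInfix h (hn.trans ?_)
  -- The `fibSubst`-image of `fibIter (2 * n)` is `fibIter (2 * n + 1)`.
  exact (fibIter_isPrefix (by omega : n ≤ 2 * n + 1)).isInfix

/-! ## Images under morphisms whose values are columns -/

/-- The letters of the leftmost column of a word, from bottom to top. -/
def Word₂.toList {A : Type} (w : Word₂ A) : List A :=
  if h : 0 < w.width then List.ofFn (w.letter ⟨0, h⟩) else []

theorem toList_column {A : Type} (l : List A) : (column l).toList = l := by
  simp [Word₂.toList, column]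

theorem eq_column_toList {A B : Type} {ω : A → Word₂ B} (h : ∀ a, ∃ l, ω a = column l) :
    ω = fun a => column (ω a).toList := by
  funext a
  obtain ⟨l, hl⟩ := h a
  rw [hl, toList_column]

theorem omega₀_eq : omega₀ = fun a => column (omega₀ a).toList :=
  eq_column_toList fun a => by fin_cases a <;> exact ⟨_, rfl⟩

theorem omega₁_eq : omega₁ = fun a => column (omega₁ a).toList :=
  eq_column_toList fun a => by fin_cases a <;> exact ⟨_, rfl⟩

theorem omega₂_eq : omega₂ = fun a => column (omega₂ a).toList :=
  eq_column_toList fun a => by fin_cases a <;> exact ⟨_, rfl⟩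

theorem omega₃_eq : omega₃ = fun a => column (omega₃ a).toList :=
  eq_column_toList fun a => by fin_cases a <;> exact ⟨_, rfl⟩

/-- Every column of `y` is obtained by expanding a column of `x` according to `f`, with the same
cuts in all columns. -/
def IsColumnImage {A B : Type} (f : A → List B) (x : Config A) (y : Config B) : Prop :=
  ∃ (k : ℤ) (r : ℤ → ℤ), ∀ i, Expands f r (fun j => x (i + k, j)) fun j => y (i, j)

theorem IsColumnImage.comp {A B C : Type} {f : A → List B} {g : B → List C} {x : Config A}
    {y : Config B} {z : Config C} (hf : IsColumnImage f x y) (hg : IsColumnImage g y z) :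
    IsColumnImage (fun a => (f a).flatMap g) x z := by
  obtain ⟨k, r, hr⟩ := hf
  obtain ⟨l, q, hq⟩ := hg
  refine ⟨l + k, q ∘ r, fun i => ?_⟩
  rw [← add_assoc]
  exact (hr (i + l)).comp (hq i)

theorem IsMorphismImage.isColumnImage {A B : Type} {f : A → List B} {x : Config A} {z : Config B}
    (h : IsMorphismImage (fun a => column (f a)) x z) (k : ℤ × ℤ) :
    IsColumnImage f x (shift k z) := by
  obtain ⟨c, r, hc, -, h⟩ := h
  have hc' : ∀ i, c i = i := by
    intro i
    induction i using Int.induction_on with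
    | zero => exact hc
    | succ i ih => rw [(h i 0).1, ih]; rfl
    | pred i ih =>
      have := (h (-i - 1) 0).1
      rw [sub_add_cancel, ih] at this
      simp only [column, Nat.cast_one] at this
      omega
  refine ⟨k.1, fun j => r j - k.2, fun i j => ⟨?_, ?_⟩⟩
  · have := (h (i + k.1) j).2.1
    simp only [column] at this
    linarith
  · refine List.ext_getElem (length_segment _ _ _) fun b hb hb' => ?_
    have := (h (i + k.1) j).2.2 ⟨0, Nat.one_pos⟩ ⟨b, hb'⟩
    rw [hc'] at this
    rw [getElem_segment]
    have e : (i, r j - k.2 + b) + k = (i + k.1, r j + b) :=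
      Prod.ext rfl (by simp only [Prod.snd_add]; ring)
    simp only [shift, e]
    simpa [column] using this

theorem exists_isColumnImage {A B : Type} {ω : A → Word₂ B} (hω : ω = fun a => column (ω a).toList)
    {X : Set (Config A)} {y : Config B} (hy : y ∈ shiftClosureImage ω X) :
    ∃ x ∈ X, IsColumnImage (fun a => (ω a).toList) x y := by
  obtain ⟨x, hx, z, hz, k, rfl⟩ := hy
  rw [hω] at hz
  exact ⟨x, hx, hz.isColumnImage k⟩

theorem exists_isMorphismImage {A B T : Type} {f : A → List B} {τ : B → T} {x : Config A}
    (hf : ∀ a, f a ≠ [])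
    (h : ∀ i i' j, (f (x (i, j))).map τ = (f (x (i', j))).map τ) :
    ∃ z, IsMorphismImage (fun a => column (f a)) x z ∧ ∀ i i' j, τ (z (i, j)) = τ (z (i', j)) := by
  have hlen : ∀ i i' j, (f (x (i, j))).length = (f (x (i', j))).length := fun i i' j => by
    simpa using congrArg List.length (h i i' j)
  obtain ⟨r, hr₀, hr⟩ := exists_cuts fun j => (f (x (0, j))).length
  have hlt : ∀ j, r j < r (j + 1) := fun j => by
    have := List.length_pos_iff.2 (hf (x (0, j)))
    have := hr j
    omega
  choose J hJ using exists_mem_block hlt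
  have hb : ∀ i p, (p - r (J p)).toNat < (f (x (i, J p))).length := fun i p => by
    rw [hlen i 0]
    have := hJ p
    have := hr (J p)
    omega
  refine ⟨fun m => (f (x (m.1, J m.2)))[(m.2 - r (J m.2)).toNat]'(hb _ _),
    ⟨id, r, rfl, hr₀, fun i j => ⟨rfl, ?_, fun a b => ?_⟩⟩, fun i i' p => ?_⟩
  · rw [hr, hlen 0 i]; rfl
  · obtain ⟨a, ha⟩ := a
    obtain ⟨b, hb⟩ := b
    replace ha : a = 0 := Nat.lt_one_iff.1 ha
    subst ha
    change b < (f (x (i, j))).length at hb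
    have e : J (r j + b) = j := by
      refine eq_of_mem_block hlt (hJ _).1 (hJ _).2 (by omega) ?_
      rw [hr, hlen 0 i]
      omega
    simp [column, e]
  · have := h i i' (J p)
    have e := congrArg (fun l => l[(p - r (J p)).toNat]?) this
    simpa [List.getElem?_eq_getElem (hb _ _)] using e

/-! ## Strips of the tilings in `X₀` -/

/-- The column of Jeandel-Rao tiles that corresponds to a tile of `tiles₅`. -/
def stripColumn (a : Fin 29) : List (Fin 11) :=
  ((((omega₃ (jmath a)).toList.flatMap fun b => (omega₂ b).toList).flatMap
    fun b => (omega₁ b).toList).flatMap fun b => (omega₀ b).toList)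

theorem exists_isColumnImage_stripColumn {y : Config (Fin 11)} (hy : y ∈ X₀) :
    ∃ x ∈ wangShift tiles₅, IsColumnImage stripColumn x y := by
  obtain ⟨x₁, hx₁, h₁⟩ := exists_isColumnImage omega₀_eq hy
  obtain ⟨x₂, hx₂, h₂⟩ := exists_isColumnImage omega₁_eq hx₁
  obtain ⟨x₃, hx₃, h₃⟩ := exists_isColumnImage omega₂_eq hx₂
  obtain ⟨x₄, ⟨x, hx, rfl⟩, h₄⟩ := exists_isColumnImage omega₃_eq hx₃
  exact ⟨x, hx, ((IsColumnImage.comp (f := fun a => (omega₃ (jmath a)).toList) h₄ h₃).comp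
    h₂).comp h₁⟩

instance (t : Fin 11) : Decidable (InT₁ t) := by unfold InT₁; infer_instance

/-- This check and the next one identify the rows of a tiling in Ω₅ with the strips of its image. -/
theorem length_stripColumn : ∀ a, (stripColumn a).length = tileHeight a := by decide +kernel

theorem inT₁_stripColumn :
    ∀ a, ∀ b : Fin (stripColumn a).length, InT₁ ((stripColumn a).get b) ↔ (b : ℕ) = 0 := by
  decide +kernel

theorem X₀_nonempty (h : (wangShift tiles₅).Nonempty) : X₀.Nonempty := by
  obtain ⟨x, hx⟩ := h
  -- The nested lists record the heights at every stage of the four morphisms. They depend only on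
  -- the tile height, hence only on the row; each application below peels off one level.
  have key : ∀ a b : Fin 29, tileHeight a = tileHeight b →
      (omega₃ (jmath a)).toList.map (fun a => (omega₂ a).toList.map fun a =>
        (omega₁ a).toList.map fun a => (omega₀ a).toList.length) =
      (omega₃ (jmath b)).toList.map fun a => (omega₂ a).toList.map fun a =>
        (omega₁ a).toList.map fun a => (omega₀ a).toList.length := by decide +kernel
  obtain ⟨x₃, hx₃, h₃⟩ := exists_isMorphismImage (f := fun a => (omega₃ a).toList)
    (x := jmath ∘ x) (by decide +kernel)
    (fun i i' j => key (x (i, j)) (x (i', j))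
      ((tileHeight_row hx i j).trans (tileHeight_row hx i' j).symm))
  obtain ⟨x₂, hx₂, h₂⟩ := exists_isMorphismImage (f := fun a => (omega₂ a).toList) (x := x₃)
    (by decide +kernel) h₃
  obtain ⟨x₁, hx₁, h₁⟩ := exists_isMorphismImage (f := fun a => (omega₁ a).toList) (x := x₂)
    (by decide +kernel) h₂
  obtain ⟨x₀, hx₀, -⟩ := exists_isMorphismImage (f := fun a => (omega₀ a).toList) (x := x₁)
    (τ := fun _ => ()) (by decide +kernel) (fun i i' j => by simp [h₁ i i' j])
  rw [← omega₃_eq] at hx₃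
  rw [← omega₂_eq] at hx₂
  rw [← omega₁_eq] at hx₁
  rw [← omega₀_eq] at hx₀
  have hs : ∀ {A : Type} (x : Config A), x = shift 0 x := fun x => by funext m; simp [shift]
  exact ⟨x₀, x₁, ⟨x₂, ⟨x₃, ⟨_, ⟨x, hx, rfl⟩, x₃, hx₃, 0, hs _⟩, x₂, hx₂, 0, hs _⟩, x₁, hx₁, 0,
    hs _⟩, x₀, hx₀, 0, hs _⟩

theorem exists_strips {y : Config (Fin 11)} (hy : y ∈ X₀) :
    ∃ x ∈ wangShift tiles₅, ∃ r : ℤ → ℤ,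
      IsStripDecomposition y r fun j => tileHeight (x (0, j)) := by
  obtain ⟨x, hx, k, r, h⟩ := exists_isColumnImage_stripColumn hy
  have hlen : ∀ i j, (stripColumn (x (i, j))).length = tileHeight (x (0, j)) := fun i j => by
    rw [length_stripColumn, tileHeight_row hx]
  have hmem : ∀ (i j : ℤ) (b : ℕ), b < tileHeight (x (0, j)) →
      (InT₁ (y (i, r j + b)) ↔ b = 0) := by
    intro i j b hb
    rw [← hlen (i + k)] at hb
    have := inT₁_stripColumn (x (i + k, j)) ⟨b, hb⟩
    rw [← this, List.get_eq_getElem]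
    have e := List.getElem_of_eq (h i j).2.symm hb
    rw [getElem_segment] at e
    rw [← e]
  have hpos : ∀ j, 0 < tileHeight (x (0, j)) := fun j => by unfold tileHeight; split <;> simp
  refine ⟨x, hx, r, fun j => ⟨⟨hpos j, fun i => ?_, fun b hb hb' i => ?_⟩, ?_⟩⟩
  · simpa using hmem i j 0 (hpos j)
  · rw [hmem i j b hb']
    exact hb.ne'
  · rw [(h 0 j).1, hlen]

/-- A strip starts exactly where τ₀ or τ₁ occurs. Two strips with the same start have the same
height, since otherwise the strip above the shorter one would start inside the longer one. -/
theorem IsStripDecomposition.exists_shift {x : Config (Fin 11)} {r r' : ℤ → ℤ} {h h' : ℤ → ℕ}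
    (hr : IsStripDecomposition x r h) (hr' : IsStripDecomposition x r' h') :
    ∃ m, ∀ n, h' n = h (n + m) := by
  have hlt : ∀ n, r n < r (n + 1) := fun n => by
    have h₁ := (hr n).1.1
    have h₂ := (hr n).2
    omega
  have hstart : ∀ p, InT₁ (x (0, p)) → ∃ n, p = r n := by
    intro p hp
    obtain ⟨n, h₁, h₂⟩ := exists_mem_block hlt p
    refine ⟨n, ?_⟩
    by_contra hne
    have h₃ := (hr n).2
    have := (hr n).1.2.2 (p - r n).toNat (by omega) (by omega) 0
    rw [show r n + ((p - r n).toNat : ℤ) = p by omega] at this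
    exact this hp
  have heq : ∀ n n', r' n' = r n → h' n' = h n := by
    intro n n' e
    have h₁ := hr n
    have h₂ := hr' n'
    have e₁ := (hr (n + 1)).1.2.1 0
    have e₂ := (hr' (n' + 1)).1.2.1 0
    by_contra hne
    rcases Nat.lt_or_gt_of_ne hne with hl | hl
    · refine h₁.1.2.2 (h' n') h₂.1.1 hl 0 ?_
      rwa [← e, ← h₂.2]
    · refine h₂.1.2.2 (h n) h₁.1.1 hl 0 ?_
      rwa [e, ← h₁.2]
  obtain ⟨m, hm⟩ := hstart (r' 0) ((hr' 0).1.2.1 0)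
  have key : ∀ n, r' n = r (n + m) := by
    intro n
    induction n using Int.induction_on with
    | zero => simpa using hm
    | succ n ih => rw [(hr' n).2, heq _ _ ih, ih, ← (hr _).2, add_right_comm]
    | pred n ih =>
      obtain ⟨l, hl⟩ := hstart (r' (-n - 1)) ((hr' _).1.2.1 0)
      have h₁ := (hr' (-n - 1)).2
      rw [sub_add_cancel, heq _ _ hl, hl, ← (hr l).2, ih] at h₁
      have := (strictMono_int_of_lt_succ hlt).injective h₁
      rw [hl]
      congr 1
      omega
  exact ⟨m, fun n => heq _ _ (key n)⟩

/-! ## Existence of tilings -/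

/-- The images of the letters of the self-similar tilings, as lists of columns. -/
def coreImages : List (List (List ℕ)) :=
  [[[0, 7], [14, 17]], [[0, 8], [14, 16]], [[2, 7], [14, 17]], [[3, 7], [9, 17]],
    [[0, 7, 6], [14, 17, 21]], [[0, 7, 8], [14, 17, 16]], [[2, 7, 8], [14, 17, 16]],
    [[3, 7, 7], [9, 17, 17]], [[3, 7, 8], [9, 17, 16]], [[10, 23], [0, 8], [14, 16]],
    [[11, 18], [1, 5], [10, 22]], [[11, 19], [1, 4], [10, 23]], [[11, 19], [1, 4], [10, 24]],
    [[12, 20], [0, 6], [13, 22]], [[12, 20], [0, 6], [14, 21]], [[12, 20], [0, 6], [15, 22]],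
    [[10, 23, 18], [0, 8, 5], [14, 16, 21]], [[10, 24, 20], [0, 7, 6], [14, 17, 21]],
    [[11, 18, 19], [1, 5, 4], [10, 22, 23]], [[11, 19, 19], [1, 4, 4], [10, 24, 20]],
    [[12, 20, 19], [0, 6, 4], [13, 22, 23]], [[12, 20, 18], [0, 6, 5], [14, 21, 21]],
    [[12, 20, 18], [0, 6, 5], [15, 22, 22]], [[12, 20, 19], [0, 6, 4], [15, 22, 23]],
    [[12, 20, 19], [0, 6, 4], [15, 22, 24]]]

/-- The blocks of sheared tiles that correspond to the letters of the self-similar tilings. -/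
def tileImages : List (List (List ℕ)) :=
  [[[14]], [[15]], [[24]], [[25]], [[14, 3]], [[14, 5]], [[24, 5]], [[25, 4]], [[25, 5]],
    [[17], [15]], [[20], [19]], [[21], [16]], [[21], [18]], [[22], [28]], [[23], [13]],
    [[27], [26]], [[17, 1], [15, 0]], [[19, 12], [14, 3]], [[20, 10], [19, 6]],
    [[21, 2], [18, 11]], [[22, 10], [28, 6]], [[23, 1], [13, 0]], [[27, 9], [26, 8]],
    [[27, 10], [26, 6]], [[27, 10], [26, 7]]]

/-- The dominoes with lower left cell in the square `[0, N)²` belong to `D`. -/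
def IsPatch (N : ℤ) (D : List Domino) (y : ℤ → ℤ → ℕ) : Prop :=
  ∀ i j, 0 ≤ i → i < N → 0 ≤ j → j < N →
    (0, y i j, y (i + 1) j) ∈ D ∧ (1, y i j, y i (j + 1)) ∈ D

/-- The letter in column `p` and row `q` of the image of `a`. -/
def imageEntry (Θ : List (List (List ℕ))) (a p q : ℕ) : ℕ :=
  (((Θ.getD a []).getD p []).getD q 0)

/-- The images listed in `Θ`, of widths `w` and heights `h`, of two letters that form a domino of
`D` fit together, and their dominoes belong to `E`. -/
structure IsSubstitution (Θ : List (List (List ℕ))) (w h : ℕ → ℕ) (D E : List Domino) : Prop where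
  width : ∀ d ∈ D, d.1 = 1 → w d.2.1 = w d.2.2
  height : ∀ d ∈ D, d.1 = 0 → h d.2.1 = h d.2.2
  inner : ∀ d ∈ D, ∀ p < w d.2.1, ∀ q < h d.2.1,
    (p + 1 < w d.2.1 →
      (0, imageEntry Θ d.2.1 p q, imageEntry Θ d.2.1 (p + 1) q) ∈ E) ∧
    (q + 1 < h d.2.1 →
      (1, imageEntry Θ d.2.1 p q, imageEntry Θ d.2.1 p (q + 1)) ∈ E)
  right : ∀ d ∈ D, d.1 = 0 → ∀ q < h d.2.1,
    (0, imageEntry Θ d.2.1 (w d.2.1 - 1) q, imageEntry Θ d.2.2 0 q) ∈ E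
  top : ∀ d ∈ D, d.1 = 1 → ∀ p < w d.2.1,
    (1, imageEntry Θ d.2.1 p (h d.2.1 - 1), imageEntry Θ d.2.2 p 0) ∈ E

set_option synthInstance.maxSize 1024 in
set_option synthInstance.maxHeartbeats 400000 in
instance (Θ : List (List (List ℕ))) (w h : ℕ → ℕ) (D E : List Domino) :
    Decidable (IsSubstitution Θ w h D E) :=
  decidable_of_iff (_ ∧ _ ∧ _ ∧ _ ∧ _)
    ⟨fun ⟨a, b, c, d, e⟩ => ⟨a, b, c, d, e⟩, fun ⟨a, b, c, d, e⟩ => ⟨a, b, c, d, e⟩⟩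

/-- Cuts between blocks of widths `u` at least `k`, the block `I m` containing the position `m`,
and the offset `o m` of the position `m` in its block. -/
theorem exists_blocks {k : ℕ} (hk : 0 < k) {u : ℤ → ℕ} (hu : ∀ i, k ≤ u i) :
    ∃ (I : ℤ → ℤ) (o : ℤ → ℕ), (∀ m, o m < u (I m)) ∧
      (∀ m, I (m + 1) = I m ∧ o (m + 1) = o m + 1 ∨
        I (m + 1) = I m + 1 ∧ o (m + 1) = 0 ∧ o m = u (I m) - 1) ∧
      ∀ (N : ℕ) (m : ℤ), 0 ≤ m → m < k * N → 0 ≤ I m ∧ I m < N := by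
  obtain ⟨c, hc₀, hc⟩ := exists_cuts u
  have hlt : ∀ i, c i < c (i + 1) := fun i => by
    have := hc i
    have := hu i
    omega
  have hmono := strictMono_int_of_lt_succ hlt
  choose I hI using exists_mem_block hlt
  have huniq : ∀ m i, c i ≤ m → m < c (i + 1) → I m = i := fun m i h₁ h₂ =>
    eq_of_mem_block hlt (hI m).1 (hI m).2 h₁ h₂
  have hN : ∀ N : ℕ, k * N ≤ c N := by
    intro N
    induction N with
    | zero => simp [hc₀]
    | succ N ih =>
      have h₁ := hu N
      have h₂ := hc N
      push_cast
      rw [mul_add, h₂]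
      omega
  refine ⟨I, fun m => (m - c (I m)).toNat, fun m => ?_, fun m => ?_, fun N m h₁ h₂ => ⟨?_, ?_⟩⟩
  · have := hI m
    have := hc (I m)
    dsimp only
    omega
  · have h₁ := hI m
    have h₂ := hc (I m)
    by_cases h : m + 1 < c (I m + 1)
    · left
      have := huniq (m + 1) (I m) (by omega) h
      dsimp only
      rw [this]
      omega
    · right
      have := huniq (m + 1) (I m + 1) (by omega) (by have := hlt (I m + 1); omega)
      dsimp only
      rw [this]
      omega
  · have := (hI m).2
    rw [← hc₀] at h₁
    have := hmono.lt_iff_lt.1 (h₁.trans_lt this)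
    omega
  · exact hmono.lt_iff_lt.1 (((hI m).1.trans_lt h₂).trans_le (hN N))

theorem IsPatch.transpose_eq {N : ℤ} {D : List Domino} {y : ℤ → ℤ → ℕ} (hy : IsPatch N D y)
    {f : ℕ → ℕ} (h : ∀ d ∈ D, d.1 = 1 → f d.2.1 = f d.2.2) {i j : ℤ} (hi : 0 ≤ i) (hi' : i < N)
    (hj : 0 ≤ j) (hj' : j < N) : f (y i j) = f (y i 0) := by
  induction j, hj using Int.leInduction with
  | base => rfl
  | succ j hj ih =>
    rw [← ih (by omega)]
    exact (h _ (hy i j hi hi' hj (by omega)).2 rfl).symm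

theorem IsPatch.row_eq {N : ℤ} {D : List Domino} {y : ℤ → ℤ → ℕ} (hy : IsPatch N D y)
    {f : ℕ → ℕ} (h : ∀ d ∈ D, d.1 = 0 → f d.2.1 = f d.2.2) {i j : ℤ} (hi : 0 ≤ i) (hi' : i < N)
    (hj : 0 ≤ j) (hj' : j < N) : f (y i j) = f (y 0 j) := by
  induction i, hi using Int.leInduction with
  | base => rfl
  | succ i hi ih =>
    rw [← ih (by omega)]
    exact (h _ (hy i j hi (by omega) hj hj').1 rfl).symm

/-- Widths are constant along the columns of a patch and heights along its rows, so row 0 and column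
0 fix common cuts. Images have sides at least `k`, so they cover a square `k` times as large. -/
theorem IsPatch.exists_image {Θ : List (List (List ℕ))} {w h : ℕ → ℕ} {D E : List Domino}
    (hΘ : IsSubstitution Θ w h D E) {k : ℕ} (hk : 0 < k) (hw : ∀ a, k ≤ w a) (hh : ∀ a, k ≤ h a)
    {N : ℕ} {y : ℤ → ℤ → ℕ} (hy : IsPatch N D y) : ∃ z, IsPatch ((k * N : ℕ) : ℤ) E z := by
  obtain ⟨I, o, hIo, hI, hIN⟩ := exists_blocks hk (u := fun i => w (y i 0)) fun _ => hw _
  obtain ⟨J, q, hJq, hJ, hJN⟩ := exists_blocks hk (u := fun j => h (y 0 j)) fun _ => hh _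
  refine ⟨fun m n => imageEntry Θ (y (I m) (J n)) (o m) (q n), fun m n hm hm' hn hn' => ?_⟩
  obtain ⟨hi, hi'⟩ := hIN N m hm (by exact_mod_cast hm')
  obtain ⟨hj, hj'⟩ := hJN N n hn (by exact_mod_cast hn')
  obtain ⟨h₀, h₁⟩ := hy _ _ hi hi' hj hj'
  have ew := hy.transpose_eq hΘ.width hi hi' hj hj'
  have eh := hy.row_eq hΘ.height hi hi' hj hj'
  have ho : o m < w (y (I m) (J n)) := ew ▸ hIo m
  have hq : q n < h (y (I m) (J n)) := eh ▸ hJq n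
  constructor
  -- The right neighbour lies in the same image, or in the first column of the next one.
  · rcases hI m with ⟨e₁, e₂⟩ | ⟨e₁, e₂, e₃⟩
    · have := hIo (m + 1)
      simp only [e₁, e₂, ← ew] at this ⊢
      exact (hΘ.inner _ h₀ _ ho _ hq).1 this
    · rw [← ew] at e₃
      simp only [e₁, e₂, e₃]
      exact hΘ.right _ h₀ rfl _ hq
  · rcases hJ n with ⟨e₁, e₂⟩ | ⟨e₁, e₂, e₃⟩
    · have := hJq (n + 1)
      simp only [e₁, e₂, ← eh] at this ⊢
      exact (hΘ.inner _ h₀ _ ho _ hq).2 this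
    · rw [← eh] at e₃
      simp only [e₁, e₂, e₃]
      exact hΘ.top _ h₁ rfl _ ho

/-- Compactness: patches of side `2 * N` are recentred at the origin, and each cell takes its limit
along a nonprincipal ultrafilter, which exists because only finitely many letters occur in `D`. -/
theorem exists_isTiling_of_isPatch {D : List Domino} (h : ∀ N : ℕ, ∃ y, IsPatch N D y) :
    ∃ x, IsTiling 0 1 D x := by
  choose y hy using h
  let F : Ultrafilter ℕ := Filter.hyperfilter ℕ
  let z : ℕ → ℤ → ℤ → ℕ := fun N i j => y (2 * N) (i + N) (j + N)
  have hz : ∀ i j, ∀ᶠ N in F, (0, z N i j, z N (i + 1) j) ∈ D ∧ (1, z N i j, z N i (j + 1)) ∈ D := by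
    intro i j
    have : ∀ᶠ N : ℕ in Filter.atTop,
        (0, z N i j, z N (i + 1) j) ∈ D ∧ (1, z N i j, z N i (j + 1)) ∈ D := by
      filter_upwards [Filter.eventually_gt_atTop i.natAbs, Filter.eventually_gt_atTop j.natAbs]
        with N h₁ h₂
      have := hy (2 * N) (i + N) (j + N) (by omega) (by push_cast; omega) (by omega)
        (by push_cast; omega)
      simp only [z]
      rwa [add_right_comm i 1, add_right_comm j 1]
    exact Nat.hyperfilter_le_atTop this
  have hlim : ∀ i j, ∃ a, ∀ᶠ N in F, z N i j = a := by
    intro i j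
    have hfin : {a | a ∈ D.map fun d => d.2.1}.Finite := List.finite_toSet _
    obtain ⟨a, -, ha⟩ := (Ultrafilter.eventually_exists_mem_iff (f := F)
      (P := fun a N => z N i j = a) hfin).1 ((hz i j).mono fun N hN =>
        ⟨_, List.mem_map.2 ⟨_, hN.1, rfl⟩, rfl⟩)
    exact ⟨a, ha⟩
  choose x hx using hlim
  refine ⟨x, fun i j => ?_⟩
  -- The limit agrees with a single patch on the three cells concerned.
  obtain ⟨N, hN, e₁, e₂, e₃⟩ := ((hz i j).and ((hx i j).and
    ((hx (i + 1) j).and (hx i (j + 1))))).exists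
  rwa [e₁, e₂, e₃] at hN

/-- The width of the image under the substitution of a letter of the self-similar tilings. -/
def coreWidth (a : ℕ) : ℕ := if a < 9 then 2 else 3

/-- The height `coreType a - 2` is 2 or 3, the length of the `coreSubst`-image of the type;
`coreType a - 3` below is 1 or 2, as for `fibSubst`. -/
theorem coreImages_isSubstitution : IsSubstitution coreImages coreWidth (fun a => coreType a - 2)
    coreDominoes coreDominoes := by decide +kernel

theorem tileImages_isSubstitution : IsSubstitution tileImages (fun a => coreWidth a - 1)
    (fun a => coreType a - 3) coreDominoes shearedDominoes := by decide +kernel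

theorem exists_isPatch_core (n : ℕ) : ∃ y, IsPatch ((2 ^ n : ℕ) : ℤ) coreDominoes y := by
  induction n with
  | zero =>
    -- The seed is the letter 0 with 13 to its right and 3 above it.
    refine ⟨fun i j => if i = 0 then if j = 0 then 0 else 3 else 13, ?_⟩
    intro i j hi hi' hj hj'
    have hi₀ : i = 0 := by simp at hi'; omega
    have hj₀ : j = 0 := by simp at hj'; omega
    subst hi₀ hj₀
    decide +kernel
  | succ n ih =>
    obtain ⟨y, hy⟩ := ih
    rw [pow_succ, mul_comm]
    refine hy.exists_image coreImages_isSubstitution two_pos (fun a => ?_) fun a => ?_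
    · unfold coreWidth; split <;> omega
    · unfold coreType; split <;> omega

theorem IsPatch.mono {M N : ℤ} {D : List Domino} {y : ℤ → ℤ → ℕ} (hy : IsPatch N D y)
    (h : M ≤ N) : IsPatch M D y := fun i j hi hi' hj hj' =>
  hy i j hi (hi'.trans_le h) hj (hj'.trans_le h)

theorem exists_isTiling_sheared : ∃ x, IsTiling 0 1 shearedDominoes x := by
  refine exists_isTiling_of_isPatch fun N => ?_
  obtain ⟨y, hy⟩ := exists_isPatch_core N
  obtain ⟨z, hz⟩ := hy.exists_image tileImages_isSubstitution one_pos
    (fun a => by unfold coreWidth; split <;> omega) (fun a => by unfold coreType; split <;> omega)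
  exact ⟨z, hz.mono (by exact_mod_cast (Nat.lt_two_pow_self.le.trans (one_mul _).ge))⟩

-- To undo the shear, the tile above a given one is found at its upper left in the sheared tiling.
-- The match of their colors is read off the 2×2 square having these two cells as a diagonal.
set_option synthInstance.maxSize 1024 in
set_option synthInstance.maxHeartbeats 400000 in
theorem wangShift_tiles₅_nonempty : (wangShift tiles₅).Nonempty := by
  obtain ⟨x, hx⟩ := exists_isTiling_sheared
  have h₀ : ∀ d ∈ shearedDominoes, d.1 = 0 →
      (tiles₅ (Fin.ofNat 29 d.2.1)).right = (tiles₅ (Fin.ofNat 29 d.2.2)).left := by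
    decide +kernel
  have h₁ : ∀ d ∈ shearedDominoes, d.1 = 1 → ∀ e ∈ shearedDominoes, e.1 = 0 → e.2.1 = d.2.1 →
      ∀ f ∈ shearedDominoes, f.1 = 1 → f.2.1 = e.2.2 → (0, d.2.2, f.2.2) ∈ shearedDominoes →
      (tiles₅ (Fin.ofNat 29 e.2.2)).top = (tiles₅ (Fin.ofNat 29 d.2.2)).bottom := by
    decide +kernel
  refine ⟨fun m => Fin.ofNat 29 (x (m.1 - m.2) m.2), fun m => ⟨?_, ?_⟩⟩
  · have := h₀ _ (hx (m.1 - m.2) m.2).1 rfl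
    simpa [add_sub_right_comm] using this
  · have := h₁ _ (hx (m.1 - m.2 - 1) m.2).2 rfl _ (hx (m.1 - m.2 - 1) m.2).1 rfl rfl
      _ (hx (m.1 - m.2 - 1 + 1) m.2).2 rfl rfl (hx (m.1 - m.2 - 1) (m.2 + 1)).1
    rw [sub_add_cancel] at this
    simpa [sub_sub] using this

/-! ## The language of the sequences of strip heights -/

theorem exists_tileHeight_eq {h : ℤ → ℕ} (hh : h ∈ stripSequences X₀) :
    ∃ x ∈ wangShift tiles₅, ∃ m, ∀ n, h n = tileHeight (x (0, n + m)) := by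
  obtain ⟨y, hy, r, hr⟩ := hh
  obtain ⟨x, hx, r', hr'⟩ := exists_strips hy
  obtain ⟨m, hm⟩ := hr'.exists_shift hr
  exact ⟨x, hx, m, hm⟩

theorem language_stripSequences_X₀ : language (stripSequences X₀) = wordLanguage fibWord := by
  ext u
  rw [mem_wordLanguage_fibWord]
  constructor
  · rintro ⟨h, hh, n, hn⟩
    obtain ⟨x, hx, m, hm⟩ := exists_tileHeight_eq hh
    have := isFibFactor_segment_tileHeight hx (n + m) u.length
    rw [hn]
    simpa only [segment, IsFibFactor, hm, add_right_comm n m, List.length_map,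
      List.length_range] using this
  · intro hu
    -- Any tiling will do, since each one contains all Fibonacci factors.
    obtain ⟨y, hy⟩ := X₀_nonempty wangShift_tiles₅_nonempty
    obtain ⟨x, hx, r, hr⟩ := exists_strips hy
    obtain ⟨p, hp⟩ := IsFibFactor.exists_segment_tileHeight hu hx
    exact ⟨_, ⟨y, hy, r, hr⟩, p, hp⟩

end JeandelRao

theorem mainTheorem7 :
    (∀ x ∈ JeandelRao.X₀, ∃ (r : ℤ → ℤ) (h : ℤ → ℕ), JeandelRao.IsStripDecomposition x r h) ∧
    (∀ h ∈ JeandelRao.stripSequences JeandelRao.X₀, ∀ n : ℤ, h n = 4 ∨ h n = 5) ∧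
    JeandelRao.language (JeandelRao.stripSequences JeandelRao.X₀) =
      JeandelRao.wordLanguage JeandelRao.fibWord := by
  refine ⟨fun y hy => ?_, fun h hh n => ?_, JeandelRao.language_stripSequences_X₀⟩
  · obtain ⟨x, -, r, hr⟩ := JeandelRao.exists_strips hy
    exact ⟨r, _, hr⟩
  · obtain ⟨x, -, m, hm⟩ := JeandelRao.exists_tileHeight_eq hh
    rw [hm, JeandelRao.tileHeight]
    split <;> simp
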